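/- Let $\mathbb{F}_q$ be a finite field with $q$ elements and characteristic greater than $3$. A (plane) conic over $\mathbb{F}_q$ is a nonzero homogeneous quadratic form in $x,y,z$ with coefficients in $\mathbb{F}_q$, up to multiplication by a nonzero scalar; its points are its zeros in $\mathbb{P}^2(\overline{\mathbb{F}}_q)$. It is smooth if it has no singular point over $\overline{\mathbb{F}}_q$, and two smooth conics intersect transversally if their tangent lines are distinct at every common point over $\overline{\mathbb{F}}_q$. Let $\Psi$ be the set of ordered pairs $(\mathcal{A},\mathcal{B})$ of smooth conics over $\mathbb{F}_q$ that intersect transversally. For $(\mathcal{A},\mathcal{B})\in\Psi$ let $E$ be the set of pairs $(P,\xi)$, defined over $\overline{\mathbb{F}}_q$, of a point $P\in\mathcal{A}$ and a line $\xi$ tangent to $\mathcal{B}$ with $P\in\xi$. Define $j:E\to E$, $j(P,\xi)=(P',\xi')$, where $P'$ is the other intersection point of $\xi$ with $\mathcal{A}$ (with $P'=P$ exactly when $\xi$ is tangent to $\mathcal{A}$ at $P$), and $\xi'$ is the other tangent line to $\mathcal{B}$ through $P'$ (with $\xi'=\xi$ exactly when $P'\in\mathcal{B}$). The pair $(\mathcal{A},\mathcal{B})$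 satisfies the Poncelet triangle condition if $j^3(P,\xi)=(P,\xi)$ for some $(P,\xi)\in E$. Let $\Gamma_3\subseteq\Psi$ be the set of pairs satisfying this condition. Then $$|\Gamma_3| = (q^5-q^2)(q+1)\,q\,(q-1)^2,$$ and therefore $$\frac{|\Gamma_3|}{|\Psi|}=\frac{q-1}{q^2-q+1}.$$ -/

import Mathlib

open scoped LinearAlgebra.Projectivization

noncomputable section

namespace Poncelet

/-- A plane conic over `K`: a nonzero homogeneous polynomial of degree `2` in three variables
with coefficients in `K`, up to multiplication by a nonzero scalar of `K`. -/
abbrev Conic (K : Type*) [Field K] : Type _ :=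
  ℙ K (MvPolynomial.homogeneousSubmodule (Fin 3) K 2)

/-- The points of the projective plane over the algebraic closure of `K`. -/
abbrev Point (K : Type*) [Field K] : Type _ :=
  ℙ (AlgebraicClosure K) (Fin 3 → AlgebraicClosure K)

/-- The lines of the projective plane over the algebraic closure of `K`, as points of the dual
plane: `[a : b : c]` is the line `a x + b y + c z = 0`. -/
abbrev Line (K : Type*) [Field K] : Type _ :=
  ℙ (AlgebraicClosure K) (Fin 3 → AlgebraicClosure K)

variable {K : Type*} [Field K]

/-- The point `P` lies on the line `ξ`. -/
def Incident (P : Point K) (ξ : Line K) : Prop :=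
  Projectivization.orthogonal P ξ

/-- A quadratic form that defines the conic `C`; it is determined up to a nonzero scalar, and
nothing below depends on the choice. -/
def Conic.form (C : Conic K) : MvPolynomial (Fin 3) K :=
  (C.rep : MvPolynomial (Fin 3) K)

/-- The geometric point `P` lies on the conic `C`. -/
def OnConic (P : Point K) (C : Conic K) : Prop :=
  MvPolynomial.aeval P.rep C.form = 0

/-- The gradient of the form of `C` at `P`; up to a nonzero scalar it is independent of the
representatives that are chosen for `C` and `P`. -/
def gradient (C : Conic K) (P : Point K) : Fin 3 → AlgebraicClosure K :=
  fun i => MvPolynomial.aeval P.rep (MvPolynomial.pderiv i C.form)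

/-- `C` is smooth: it has no singular point over the algebraic closure. -/
def IsSmooth (C : Conic K) : Prop :=
  ∀ P : Point K, OnConic P C → gradient C P ≠ 0

/-- `A` and `B` intersect transversally: at each common point over the algebraic closure both
are nonsingular and their tangent lines are distinct. -/
def IsTransversal (A B : Conic K) : Prop :=
  ∀ P : Point K, OnConic P A → OnConic P B →
    LinearIndependent (AlgebraicClosure K) ![gradient A P, gradient B P]

/-- `ξ` is the tangent line of `C` at the (nonsingular) point `P` of `C`. -/
def IsTangentAt (C : Conic K) (P : Point K) (ξ : Line K) : Prop :=
  OnConic P C ∧ ∃ c : AlgebraicClosure K, c ≠ 0 ∧ gradient C P = c • ξ.rep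

/-- The dual conic: the set of all tangent lines of `C`. -/
def dualConic (C : Conic K) : Set (Line K) :=
  {ξ | ∃ Q : Point K, IsTangentAt C Q ξ}

/-- The pairs `(P, ξ)` of a point `P` of `A` and a tangent line `ξ` of `B` through `P`. -/
def incidenceCurve (A B : Conic K) : Set (Point K × Line K) :=
  {e | OnConic e.1 A ∧ e.2 ∈ dualConic B ∧ Incident e.1 e.2}

/-- The graph of the Poncelet map `j : (P, ξ) ↦ (P', ξ')`: the point `P'` is the other
intersection point of `ξ` with `A`, and `ξ'` is the other tangent line to `B` through `P'`.
Multiplicities are counted: `P' = P` exactly if `ξ` touches `A` at `P`, and `ξ' = ξ` exactly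
if `P'` lies on `B`. -/
def PonceletStep (A B : Conic K) (e e' : Point K × Line K) : Prop :=
  e ∈ incidenceCurve A B ∧ e' ∈ incidenceCurve A B ∧
    Incident e'.1 e.2 ∧ (e'.1 = e.1 ↔ IsTangentAt A e.1 e.2) ∧
    (e'.2 = e.2 ↔ OnConic e'.1 B)

/-- The Poncelet triangle condition: `j (j (j e)) = e` for some initial datum `e`. -/
def PonceletTriangle (A B : Conic K) : Prop :=
  ∃ e₀ e₁ e₂ : Point K × Line K,
    PonceletStep A B e₀ e₁ ∧ PonceletStep A B e₁ e₂ ∧ PonceletStep A B e₂ e₀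

/-- The ordered pairs of smooth conics over `K` with transversal intersection. -/
def Psi (K : Type*) [Field K] : Set (Conic K × Conic K) :=
  {p | IsSmooth p.1 ∧ IsSmooth p.2 ∧ IsTransversal p.1 p.2}

/-- The pairs in `Psi K` that satisfy the Poncelet triangle condition. -/
def Gamma3 (K : Type*) [Field K] : Set (Conic K × Conic K) :=
  {p | p ∈ Psi K ∧ PonceletTriangle p.1 p.2}

end Poncelet

end

/-!
The answer `(q ^ 5 - q ^ 2) * (q + 1) * q * (q - 1) ^ 2` is the order of `GL₃(F_q)`, and this is how
it arises. A pair of conics is a pair of symmetric `3 × 3` matrices `A`, `B` up to scaling each of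
them. If `A` is invertible then `A⁻¹ * B` is conjugate to its transpose by a symmetric matrix, so
for every squarefree monic cubic `f` there are exactly `|GL₃(F_q)|` pairs with
`(A⁻¹ * B).charpoly = f`. Both conditions to be counted depend on this cubic alone:

* the conics are smooth and meet transversally if and only if `f` is squarefree and `f 0 ≠ 0`, since
  a point of tangency is an isotropic eigenvector of `A⁻¹ * B`;
* they then satisfy the Poncelet triangle condition if and only if the coefficients of `f` satisfy
  Cayley's equation `c₁ ^ 2 = 4 * c₀ * c₂`. In the coordinates given by the vertices of a triangle,
  the equation is an identity. Conversely, from a common point `q` of the conics draw the tangent to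
  the second conic, let `p` be its other point on the first, and draw the other tangent from `p`:
  Cayley's equation says that this one touches the first conic at `p`, so that the degenerate
  triangle `q, p, p` closes up.

Since `(q - 1) ^ 2` of the squarefree cubics with `f 0 ≠ 0` satisfy Cayley's equation, and rescaling
`A` and `B` accounts for a factor `(q - 1) ^ 2` as well, `|GL₃(F_q)|` pairs of conics remain.
-/

noncomputable section

namespace Poncelet

open Polynomial Matrix
open LinearMap (BilinForm)

section SimultaneousForms

variable {K : Type*} [Field K] {n : Type*} [Fintype n] [DecidableEq n]

lemma exists_charmatrix_mul_eq (M : Matrix n n K) (p : K[X]) :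
    ∃ Q, charmatrix M * Q = scalar n p - (aeval M p).map C := by
  induction p using Polynomial.induction_on' with
  | add p q hp hq =>
    obtain ⟨P, hP⟩ := hp
    obtain ⟨Q, hQ⟩ := hq
    refine ⟨P + Q, ?_⟩
    rw [mul_add, hP, hQ, map_add, map_add, Matrix.map_add _ (fun _ _ => C_add)]
    abel
  | monomial k a =>
    obtain ⟨Q, hQ⟩ : charmatrix M ∣ scalar n X ^ k - M.map C ^ k :=
      (scalar_commute (n := n) X (Commute.all X) (M.map C)).sub_dvd_pow_sub_pow k
    refine ⟨C a • Q, ?_⟩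
    rw [Matrix.mul_smul, ← hQ, smul_sub, ← C_mul_X_pow_eq_monomial, map_mul, map_mul, map_pow,
      map_pow, aeval_X, aeval_C, ← Algebra.smul_def, Matrix.map_smul' _ a _ fun _ _ => C_mul,
      ← RingHom.mapMatrix_apply C (M ^ k), map_pow, RingHom.mapMatrix_apply]
    simp [smul_eq_diagonal_mul]

lemma charpoly_dvd_pow_of_aeval_eq_zero {M : Matrix n n K} {p : K[X]} (hp : aeval M p = 0) :
    M.charpoly ∣ p ^ Fintype.card n := by
  obtain ⟨Q, hQ⟩ := exists_charmatrix_mul_eq M p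
  refine ⟨Q.det, ?_⟩
  rw [Matrix.charpoly, ← det_mul, hQ, hp]
  simp

lemma minpoly_eq_charpoly {M : Matrix n n K} (hM : Squarefree M.charpoly) :
    minpoly K M = M.charpoly :=
  eq_of_monic_of_associated (minpoly.monic M.isIntegral) M.charpoly_monic <|
    associated_of_dvd_dvd M.minpoly_dvd_charpoly <|
      hM.isRadical _ _ (charpoly_dvd_pow_of_aeval_eq_zero (minpoly.aeval K M))

lemma nonempty_AEval_equiv {M : Matrix n n K} (hM : Squarefree M.charpoly) :
    Nonempty ((K[X] ⧸ Ideal.span {M.charpoly}) ≃ₗ[K[X]] Module.AEval' (toLin' M)) := by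
  obtain ⟨v, hv⟩ :=
    Module.exists_ker_toSpanSingleton_eq_annihilator K[X] (Module.AEval' (toLin' M))
  rw [← span_minpoly_eq_annihilator, Matrix.minpoly_toLin', minpoly_eq_charpoly hM, eq_comm] at hv
  let φ := Submodule.liftQ _ _ hv.le
  have hinj : Function.Injective φ := LinearMap.ker_eq_bot.mp (Submodule.ker_liftQ_eq_bot' _ _ hv)
  have : FiniteDimensional K (K[X] ⧸ Ideal.span {M.charpoly}) :=
    M.charpoly_monic.finite_quotient
  have hrank : Module.finrank K (K[X] ⧸ Ideal.span {M.charpoly}) =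
      Module.finrank K (Module.AEval' (toLin' M)) := by
    rw [finrank_quotient_span_eq_natDegree, M.charpoly_natDegree_eq_dim,
      ← (Module.AEval'.of (toLin' M)).finrank_eq, Module.finrank_fintype_fun_eq_card]
  exact ⟨.ofBijective φ ⟨hinj, (LinearMap.injective_iff_surjective_of_finrank_eq_finrank
    (f := φ.restrictScalars K) hrank).mp hinj⟩⟩

lemma exists_semiconjBy {M N : Matrix n n K} (hMN : M.charpoly = N.charpoly)
    (hM : Squarefree M.charpoly) : ∃ g : GL n K, SemiconjBy g.val M N := by
  obtain ⟨e⟩ := nonempty_AEval_equiv hM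
  obtain ⟨e'⟩ := nonempty_AEval_equiv (hMN ▸ hM)
  let ψ : Module.AEval' (toLin' M) ≃ₗ[K[X]] Module.AEval' (toLin' N) :=
    e.symm ≪≫ₗ Submodule.quotEquivOfEq _ _ (by rw [hMN]) ≪≫ₗ e'
  let φ : (n → K) ≃ₗ[K] n → K :=
    Module.AEval'.of _ ≪≫ₗ ψ.restrictScalars K ≪≫ₗ (Module.AEval'.of _).symm
  have hφ (x : n → K) : φ (M *ᵥ x) = N *ᵥ φ x := by
    change (Module.AEval'.of _).symm (ψ (Module.AEval'.of _ (toLin' M x))) = _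
    rw [← Module.AEval'.X_smul_of, map_smul, Module.AEval'.of_symm_X_smul]
    rfl
  let g : GL n K := GeneralLinearGroup.toLin.symm (.ofLinearEquiv φ)
  have hg (x : n → K) : g.val *ᵥ x = φ x :=
    congrArg (fun u : LinearMap.GeneralLinearGroup K (n → K) => u.val x)
      (GeneralLinearGroup.toLin.apply_symm_apply (.ofLinearEquiv φ))
  refine ⟨g, toLin'.injective (LinearMap.ext fun x => ?_)⟩
  rw [toLin'_apply, toLin'_apply, ← mulVec_mulVec, ← mulVec_mulVec, hg, hg, hφ]

lemma exists_aeval_mulVec_eq {M : Matrix n n K} (hM : Squarefree M.charpoly) :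
    ∃ v : n → K, ∀ w, ∃ p : K[X], aeval M p *ᵥ v = w := by
  obtain ⟨e⟩ := nonempty_AEval_equiv hM
  refine ⟨(Module.AEval'.of _).symm (e (Submodule.Quotient.mk 1)), fun w => ?_⟩
  obtain ⟨p, hp⟩ := Submodule.Quotient.mk_surjective _ (e.symm (Module.AEval'.of _ w))
  rw [← mul_one p, ← smul_eq_mul, Submodule.Quotient.mk_smul, LinearEquiv.eq_symm_apply,
    map_smul] at hp
  refine ⟨p, ?_⟩
  rw [← LinearEquiv.symm_apply_eq, Module.AEval.of_symm_smul] at hp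
  rw [← hp, ← toLinAlgEquiv'_apply, ← aeval_algHom_apply]
  rfl

lemma isSymm_of_semiconjBy_transpose {M N : Matrix n n K} (hM : Squarefree M.charpoly)
    (hN : SemiconjBy N M Mᵀ) : N.IsSymm := by
  have hcomm (p : K[X]) : N * aeval M p = (aeval M p)ᵀ * N := by
    induction p using Polynomial.induction_on' with
    | add p q hp hq => rw [map_add, mul_add, hp, hq, transpose_add, add_mul]
    | monomial k a =>
      rw [aeval_monomial, ← Algebra.smul_def, transpose_smul, transpose_pow, mul_smul_comm,
        smul_mul_assoc, (hN.pow_right k).eq]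
  obtain ⟨v, hv⟩ := exists_aeval_mulVec_eq hM
  have key (p q : K[X]) :
      (aeval M p *ᵥ v) ⬝ᵥ N *ᵥ (aeval M q *ᵥ v) = v ⬝ᵥ N *ᵥ (aeval M (p * q) *ᵥ v) := by
    rw [map_mul, ← mulVec_mulVec, mulVec_mulVec _ N (aeval M p), hcomm, ← mulVec_mulVec,
      dotProduct_mulVec v, vecMul_transpose]
  ext i j
  obtain ⟨p, hp⟩ := hv (Pi.single i 1)
  obtain ⟨q, hq⟩ := hv (Pi.single j 1)
  have hij := key p q
  rw [mul_comm, ← key, hp, hq] at hij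
  simpa using hij.symm

lemma exists_charpoly_eq {f : K[X]} (hf : f.Monic) (hn : f.natDegree = Fintype.card n) :
    ∃ M : Matrix n n K, M.charpoly = f := by
  let pb := AdjoinRoot.powerBasis hf.ne_zero
  let e : Fin pb.dim ≃ n := Fintype.equivOfCardEq (by simp [pb, hn])
  refine ⟨reindex e e (Algebra.leftMulMatrix pb.basis pb.gen), ?_⟩
  rw [charpoly_reindex, charpoly_leftMulMatrix, AdjoinRoot.minpoly_powerBasis_gen_of_monic hf]

/-- The characteristic polynomial of the symmetric form `B` relative to the form `A`, that is
`det (X A - B) / det A`. -/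
def relCharpoly (A B : Matrix n n K) : K[X] := (A⁻¹ * B).charpoly

/-- If `C` is a fixed matrix similar to `Mᵀ`, say `h Mᵀ = C h`, then `A M = Mᵀ A` says that `h A`
conjugates `M` into `C`; so the pair `(A, M)` can be recovered from `h A`. -/
lemma nonempty_semiconjBy_transpose_equiv {f : K[X]} (hf : f.Monic)
    (hn : f.natDegree = Fintype.card n) (hsf : Squarefree f) :
    Nonempty ({p : GL n K × Matrix n n K // SemiconjBy p.1.val p.2 p.2ᵀ ∧ p.2.charpoly = f} ≃
      GL n K) := by
  obtain ⟨C, hC⟩ := exists_charpoly_eq hf hn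
  have hsim (M : Matrix n n K) : ∃ h : GL n K, M.charpoly = f → SemiconjBy h.val Mᵀ C := by
    by_cases hM : M.charpoly = f
    · obtain ⟨h, hh⟩ := exists_semiconjBy (M := Mᵀ) (N := C)
        (by rw [charpoly_transpose, hM, hC]) (by rwa [charpoly_transpose, hM])
      exact ⟨h, fun _ => hh⟩
    · exact ⟨1, fun h => absurd h hM⟩
  choose h hh using hsim
  have hconj (g : GL n K) : SemiconjBy g.val (g⁻¹.val * C * g.val) C := by
    rw [SemiconjBy, mul_assoc, Units.mul_inv_cancel_left]
  have hcharpoly (g : GL n K) : (g⁻¹.val * C * g.val).charpoly = f := by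
    rw [← hC, coe_units_inv, charpoly_units_conj']
  refine ⟨{
    toFun p := h p.1.2 * p.1.1
    invFun g := ⟨((h (g⁻¹.val * C * g.val))⁻¹ * g, g⁻¹.val * C * g.val),
      (hh _ (hcharpoly g)).units_inv_symm_left.mul_left (hconj g), hcharpoly g⟩
    left_inv := ?_
    right_inv g := mul_inv_cancel_left _ _ }⟩
  rintro ⟨⟨A, M⟩, hAM, hM⟩
  have hM : (h M * A)⁻¹.val * C * (h M * A).val = M := by
    rw [mul_assoc, Units.inv_mul_eq_iff_eq_mul, Units.val_mul]
    exact ((hh M hM).mul_left hAM).eq.symm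
  simp only [hM, inv_mul_cancel_left]

lemma semiconjBy_inv_mul {A B : Matrix n n K} (hA : A.IsSymm) (hB : B.IsSymm)
    (hdet : A.det ≠ 0) : SemiconjBy A (A⁻¹ * B) (A⁻¹ * B)ᵀ := by
  rw [SemiconjBy, mul_nonsing_inv_cancel_left _ _ hdet.isUnit, transpose_mul,
    transpose_nonsing_inv, hA, hB, nonsing_inv_mul_cancel_right _ _ hdet.isUnit]

lemma nonempty_relCharpoly_fiber_equiv {f : K[X]} (hf : f.Monic)
    (hn : f.natDegree = Fintype.card n) (hsf : Squarefree f) :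
    Nonempty ({p : Matrix n n K × Matrix n n K // p.1.IsSymm ∧ p.2.IsSymm ∧ p.1.det ≠ 0 ∧
      relCharpoly p.1 p.2 = f} ≃ GL n K) := by
  obtain ⟨e⟩ := nonempty_semiconjBy_transpose_equiv hf hn hsf
  have hdet (g : GL n K) : IsUnit g.val.det := g.val.isUnit_iff_isUnit_det.mp g.isUnit
  refine ⟨Equiv.trans {
    toFun p := ⟨(GeneralLinearGroup.mkOfDetNeZero p.1.1 p.2.2.2.1, p.1.1⁻¹ * p.1.2),
      semiconjBy_inv_mul p.2.1 p.2.2.1 p.2.2.2.1, p.2.2.2.2⟩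
    invFun p := ⟨(p.1.1.val, p.1.1.val * p.1.2), ?_⟩
    left_inv p := Subtype.ext <|
      Prod.ext rfl (mul_nonsing_inv_cancel_left _ _ p.2.2.2.1.isUnit)
    right_inv p := Subtype.ext <|
      Prod.ext (Units.ext rfl) (nonsing_inv_mul_cancel_left _ _ (hdet p.1.1)) } e⟩
  obtain ⟨⟨A, M⟩, hAM, hM⟩ := p
  have hA : A.val.IsSymm := isSymm_of_semiconjBy_transpose (by rwa [hM]) hAM
  refine ⟨hA, ?_, (hdet A).ne_zero, ?_⟩
  · rw [IsSymm, transpose_mul, hA, hAM.eq]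
  · rwa [relCharpoly, nonsing_inv_mul_cancel_left _ _ (hdet A)]

lemma card_isSymm_pairs {R : K[X] → Prop} (hR : ∀ f, R f → Squarefree f) :
    Nat.card {p : Matrix n n K × Matrix n n K //
        (p.1.IsSymm ∧ p.2.IsSymm ∧ p.1.det ≠ 0) ∧ R (relCharpoly p.1 p.2)} =
      Nat.card {f : K[X] // (f.Monic ∧ f.natDegree = Fintype.card n) ∧ R f} *
        Nat.card (GL n K) := by
  let χ : {p : Matrix n n K × Matrix n n K //
      (p.1.IsSymm ∧ p.2.IsSymm ∧ p.1.det ≠ 0) ∧ R (relCharpoly p.1 p.2)} →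
      {f : K[X] // (f.Monic ∧ f.natDegree = Fintype.card n) ∧ R f} :=
    fun p => ⟨relCharpoly p.1.1 p.1.2,
      ⟨charpoly_monic _, charpoly_natDegree_eq_dim _⟩, p.2.2⟩
  have hχ (f) : Nonempty ({p // χ p = f} ≃ GL n K) := by
    obtain ⟨f, ⟨hf, hn⟩, hRf⟩ := f
    obtain ⟨e⟩ := nonempty_relCharpoly_fiber_equiv hf hn (hR f hRf)
    exact ⟨.trans {
      toFun p := ⟨p.1.1, p.1.2.1.1, p.1.2.1.2.1, p.1.2.1.2.2, congrArg Subtype.val p.2⟩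
      invFun p := ⟨⟨p.1, ⟨p.2.1, p.2.2.1, p.2.2.2.1⟩, (congrArg R p.2.2.2.2).mpr hRf⟩,
        Subtype.ext p.2.2.2.2⟩ }
      e⟩
  rw [Nat.card_congr ((Equiv.sigmaFiberEquiv χ).symm.trans
    (Equiv.sigmaEquivProdOfEquiv fun f => (hχ f).some)), Nat.card_prod]

end SimultaneousForms

section Cubics

variable {K : Type*} [Field K]

lemma exists_eq_sq_mul_of_not_squarefree {f : K[X]} (hf : f.Monic) (hn : f.natDegree = 3)
    (hsf : ¬ Squarefree f) : ∃ r s, f = (X - C r) ^ 2 * (X - C s) := by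
  obtain ⟨g, ⟨h, rfl⟩, hg⟩ : ∃ g, g * g ∣ f ∧ ¬ IsUnit g := by simpa [Squarefree] using hsf
  have hg0 : g ≠ 0 := by rintro rfl; simp at hn
  have hh0 : h ≠ 0 := by rintro rfl; simp at hn
  have hdeg : g.natDegree + g.natDegree + h.natDegree = 3 := by
    rwa [natDegree_mul (mul_ne_zero hg0 hg0) hh0, natDegree_mul hg0 hg0] at hn
  have hg1 : g.natDegree = 1 := by
    have := natDegree_pos_iff_degree_pos.mpr (degree_pos_of_ne_zero_of_nonunit hg0 hg)
    omega
  obtain ⟨r, hr⟩ := exists_root_of_degree_eq_one (degree_eq_iff_natDegree_eq hg0 |>.mpr hg1)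
  obtain ⟨k, hk⟩ : (X - C r) ^ 2 ∣ g * g * h := by
    rw [sq]
    exact (mul_dvd_mul (dvd_iff_isRoot.mpr hr) (dvd_iff_isRoot.mpr hr)).mul_right h
  have hX : ((X - C r) ^ 2).Monic := (monic_X_sub_C r).pow 2
  have hkm : k.Monic := hX.of_mul_monic_left (hk ▸ hf)
  have hk1 : k.natDegree = 1 := by
    rw [hk, hX.natDegree_mul hkm, natDegree_pow, natDegree_X_sub_C] at hn
    omega
  refine ⟨r, -k.coeff 0, ?_⟩
  rw [hk, C_neg, sub_neg_eq_add, ← hkm.eq_X_add_C hk1]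

lemma sq_mul_linear_injective :
    Function.Injective fun p : K × K => (X - C p.1) ^ 2 * (X - C p.2) := by
  classical
  rintro ⟨r, s⟩ ⟨r', s'⟩ h
  have hroots (a b : K) : ((X - C a) ^ 2 * (X - C b)).roots = {a, a, b} := by
    rw [roots_mul (mul_ne_zero (pow_ne_zero 2 (X_sub_C_ne_zero a)) (X_sub_C_ne_zero b)), roots_pow,
      roots_X_sub_C, roots_X_sub_C, two_nsmul]
    rfl
  have hcount := congrArg roots h
  rw [hroots, hroots] at hcount
  have hr := congrArg (Multiset.count r) hcount
  have hs := congrArg (Multiset.count s) hcount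
  simp only [Multiset.insert_eq_cons, Multiset.count_cons, Multiset.count_singleton] at hr hs
  grind

lemma sq_mul_linear_monic (r s : K) : ((X - C r) ^ 2 * (X - C s)).Monic :=
  ((monic_X_sub_C r).pow 2).mul (monic_X_sub_C s)

lemma sq_mul_linear_natDegree (r s : K) : ((X - C r) ^ 2 * (X - C s)).natDegree = 3 := by
  compute_degree!

/-- A monic cubic polynomial, given by its lower coefficients in descending order. -/
def monicCubicEquiv : {f : K[X] // f.Monic ∧ f.natDegree = 3} ≃ K × K × K where
  toFun f := (f.1.coeff 2, f.1.coeff 1, f.1.coeff 0)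
  invFun c := ⟨(⟨1, c.1, c.2.1, c.2.2⟩ : Cubic K).toPoly, Cubic.monic_of_a_eq_one',
    Cubic.natDegree_of_a_ne_zero' one_ne_zero⟩
  left_inv f := Subtype.ext <| by
    conv_rhs => rw [f.1.as_sum_range_C_mul_X_pow, f.2.2]
    have hlead : f.1.coeff 3 = 1 := by
      rw [← f.2.1.coeff_natDegree, f.2.2]
    simp only [Cubic.toPoly, Finset.sum_range_succ, Finset.sum_range_zero, hlead]
    ring
  right_inv c := by simp

lemma card_squarefree_cubics_add [Finite K] (Q : K[X] → Prop) :
    Nat.card {f : K[X] // (f.Monic ∧ f.natDegree = 3) ∧ Squarefree f ∧ Q f} +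
      Nat.card {p : K × K // Q ((X - C p.1) ^ 2 * (X - C p.2))} =
      Nat.card {f : K[X] // (f.Monic ∧ f.natDegree = 3) ∧ Q f} := by
  classical
  have : Finite {f : K[X] // f.Monic ∧ f.natDegree = 3} := .of_equiv _ monicCubicEquiv.symm
  let S := {f : K[X] | (f.Monic ∧ f.natDegree = 3) ∧ Q f}
  have hS : S.Finite :=
    Set.Finite.subset (s := {f : K[X] | f.Monic ∧ f.natDegree = 3}) ‹_› fun _ h => h.1
  have hsf : S ∩ {f | Squarefree f} =
      {f : K[X] | (f.Monic ∧ f.natDegree = 3) ∧ Squarefree f ∧ Q f} := by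
    ext f
    simp only [S, Set.mem_inter_iff, Set.mem_ofPred_eq]
    tauto
  have hnsf : S \ {f | Squarefree f} =
      (fun p : K × K => (X - C p.1) ^ 2 * (X - C p.2)) ''
        {p | Q ((X - C p.1) ^ 2 * (X - C p.2))} := by
    ext f
    constructor
    · rintro ⟨⟨⟨hf, hn⟩, hQ⟩, hsf⟩
      obtain ⟨r, s, rfl⟩ := exists_eq_sq_mul_of_not_squarefree hf hn hsf
      exact ⟨(r, s), hQ, rfl⟩
    · rintro ⟨⟨r, s⟩, hQ, rfl⟩
      refine ⟨⟨⟨sq_mul_linear_monic r s, sq_mul_linear_natDegree r s⟩, hQ⟩, fun hsf => ?_⟩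
      exact not_isUnit_X_sub_C r (hsf _ (sq (X - C r) ▸ dvd_mul_right _ _))
  have := Set.ncard_inter_add_ncard_sdiff_eq_ncard S {f | Squarefree f} hS
  rwa [hsf, hnsf, Set.ncard_image_of_injective _ sq_mul_linear_injective] at this

/-- Cayley's condition on the relative characteristic polynomial `f` of two conics: the
coefficient of `X ^ 2` in the power series expansion of `√f` vanishes. -/
def IsCayley (f : K[X]) : Prop := f.coeff 1 ^ 2 = 4 * f.coeff 0 * f.coeff 2

lemma sq_mul_linear_coeff (r s : K) :
    ((X - C r) ^ 2 * (X - C s)).coeff 0 = -(r ^ 2 * s) ∧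
    ((X - C r) ^ 2 * (X - C s)).coeff 1 = r ^ 2 + 2 * r * s ∧
    ((X - C r) ^ 2 * (X - C s)).coeff 2 = -(2 * r + s) := by
  have h : (X - C r) ^ 2 * (X - C s) =
      (⟨1, -(2 * r + s), r ^ 2 + 2 * r * s, -(r ^ 2 * s)⟩ : Cubic K).toPoly := by
    simp only [Cubic.toPoly, map_neg, map_add, map_mul, map_pow, map_one, map_ofNat]
    ring
  simp [h]

lemma card_squarefree_cubics [Finite K] :
    Nat.card {f : K[X] // (f.Monic ∧ f.natDegree = 3) ∧ Squarefree f ∧ f.coeff 0 ≠ 0} +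
      Nat.card Kˣ ^ 2 = Nat.card K ^ 2 * Nat.card Kˣ := by
  have hns : Nat.card {p : K × K // ((X - C p.1) ^ 2 * (X - C p.2)).coeff 0 ≠ 0} =
      Nat.card Kˣ ^ 2 := by
    rw [sq, ← Nat.card_prod]
    refine Nat.card_congr (.trans (.subtypeEquivRight fun p => ?_)
      (.trans .subtypeProdEquivProd (unitsEquivNeZero.symm.prodCongr unitsEquivNeZero.symm)))
    simp [(sq_mul_linear_coeff p.1 p.2).1]
  rw [← hns, card_squarefree_cubics_add, sq, mul_assoc, ← Nat.card_prod, ← Nat.card_prod]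
  let e : {c : K × K × K // c.2.2 ≠ 0} ≃ K × K × Kˣ :=
    { toFun c := (c.1.1, c.1.2.1, .mk0 _ c.2)
      invFun c := ⟨(c.1, c.2.1, c.2.2), c.2.2.ne_zero⟩
      right_inv c := by simp }
  exact Nat.card_congr <| (Equiv.subtypeSubtypeEquivSubtypeInter _ _).symm.trans <|
    (monicCubicEquiv.subtypeEquiv fun _ => .rfl).trans e

lemma card_squarefree_isCayley_cubics [Finite K] (h2 : (2 : K) ≠ 0) :
    Nat.card {f : K[X] //
        (f.Monic ∧ f.natDegree = 3) ∧ Squarefree f ∧ f.coeff 0 ≠ 0 ∧ IsCayley f} +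
      Nat.card Kˣ = Nat.card K * Nat.card Kˣ := by
  have h4 : (4 : K) ≠ 0 := by convert mul_ne_zero h2 h2; norm_num
  have hroots (r s : K) :
      -(r ^ 2 * s) ≠ 0 ∧ (r ^ 2 + 2 * r * s) ^ 2 = 4 * -(r ^ 2 * s) * -(2 * r + s) ↔
        s ≠ 0 ∧ r = 4 * s := by
    constructor
    · intro h
      have hr : r ≠ 0 := by rintro rfl; simp at h
      refine ⟨by rintro rfl; simp at h, mul_left_cancel₀ (pow_ne_zero 3 hr) ?_⟩
      linear_combination h.2
    · rintro ⟨hs, rfl⟩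
      exact ⟨neg_ne_zero.mpr (mul_ne_zero (pow_ne_zero 2 (mul_ne_zero h4 hs)) hs), by ring⟩
  let Q (f : K[X]) : Prop := f.coeff 0 ≠ 0 ∧ IsCayley f
  let d : {p : K × K // p.2 ≠ 0 ∧ p.1 = 4 * p.2} ≃ Kˣ :=
    { toFun p := .mk0 p.1.2 p.2.1
      invFun s := ⟨(4 * s, s), s.ne_zero, rfl⟩
      left_inv p := Subtype.ext <| Prod.ext p.2.2.symm rfl
      right_inv s := by simp }
  have hns : Nat.card {p : K × K // Q ((X - C p.1) ^ 2 * (X - C p.2))} = Nat.card Kˣ :=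
    Nat.card_congr <| .trans (.subtypeEquivRight fun p => by
      simpa only [Q, IsCayley, sq_mul_linear_coeff] using hroots p.1 p.2) d
  let e : {c : K × K × K // c.2.2 ≠ 0 ∧ c.2.1 ^ 2 = 4 * c.2.2 * c.1} ≃ K × Kˣ :=
    { toFun c := (c.1.2.1, .mk0 _ c.2.1)
      invFun c := ⟨(c.1 ^ 2 / (4 * c.2), c.1, c.2), c.2.ne_zero,
        (mul_div_cancel₀ _ (mul_ne_zero h4 c.2.ne_zero)).symm⟩
      left_inv c := Subtype.ext <| Prod.ext
        ((div_eq_iff (mul_ne_zero h4 c.2.1)).mpr (c.2.2.trans (mul_comm _ _))) rfl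
      right_inv c := by simp }
  rw [← hns, card_squarefree_cubics_add Q, hns, ← Nat.card_prod]
  exact Nat.card_congr <| (Equiv.subtypeSubtypeEquivSubtypeInter _ _).symm.trans <|
    (monicCubicEquiv.subtypeEquiv fun _ => .rfl).trans e

end Cubics

section IsotropicVectors

variable {F V : Type*} [Field F] [AddCommGroup V] [Module F V] {α β : BilinForm F V}

lemma linearIndependent_pair_map_iff {W : Type*} [AddCommGroup W] [Module F W] {f : V →ₗ[F] W}
    (hf : Function.Injective f) {x y : V} :
    LinearIndependent F ![f x, f y] ↔ LinearIndependent F ![x, y] := by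
  simp only [LinearIndependent.pair_iff, ← map_smul, ← map_add, map_eq_zero_iff f hf]

lemma exists_isotropic_of_linearIndependent (h2 : (2 : F) ≠ 0) (hα : α.IsSymm) {q : V}
    (hq : α q q = 0) {ℓ : Module.Dual F V} (hℓ : ℓ q = 0) (hli : LinearIndependent F ![ℓ, α q]) :
    ∃ p, α p p = 0 ∧ ℓ p = 0 ∧ α p q ≠ 0 := by
  obtain ⟨s, hs, hqs⟩ : ∃ s, ℓ s = 0 ∧ α s q ≠ 0 := by
    by_contra! h
    have hker : ⨅ _ : Unit, LinearMap.ker ℓ ≤ LinearMap.ker (α q) :=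
      fun x hx => (hα.eq q x).trans (h x (by simpa using hx))
    obtain ⟨a, ha⟩ : ∃ a, a • ℓ = α q := by
      simpa [Submodule.mem_span_singleton] using mem_span_of_iInf_ker_le_ker hker
    exact (LinearIndependent.pair_iff' (hli.ne_zero 0)).mp hli a ha
  refine ⟨s - (α s s / (2 * α s q)) • q, ?_, by simp [hs, hℓ], by simpa [hq] using hqs⟩
  simp only [map_sub, map_smul, LinearMap.sub_apply, LinearMap.smul_apply, smul_eq_mul, hq,
    hα.eq q s]
  field_simp
  ring

lemma linearIndependent_of_isotropic {p q : V} (hp : α p p = 0)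
    (hpq : α p q ≠ 0) : LinearIndependent F ![p, q] := by
  refine (LinearIndependent.pair_iff' fun h => hpq (by simp [h])).mpr fun a ha => ?_
  exact hpq (by rw [← ha, map_smul, hp, smul_zero])

lemma exists_isotropic_mem [IsAlgClosed F] (α : BilinForm F V) {W : Submodule F V}
    (hW : 1 < Module.finrank F W) : ∃ w ∈ W, w ≠ 0 ∧ α w w = 0 := by
  have : Nontrivial W := Module.nontrivial_of_finrank_pos (R := F) (by omega)
  obtain ⟨y, hy⟩ := exists_ne (0 : W)
  obtain ⟨x, hxy⟩ := exists_linearIndependent_pair_of_one_lt_finrank hW hy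
  by_cases hyy : α y y = 0
  · exact ⟨y, y.2, by simpa using hy, hyy⟩
  have hdeg : (C (α y y) * X ^ 2 + C (α x y + α y x) * X + C (α x x)).degree ≠ 0 := by
    rw [degree_quadratic hyy]
    decide
  obtain ⟨t, ht⟩ := IsAlgClosed.exists_root _ hdeg
  refine ⟨t • y + x, W.add_mem (W.smul_mem t y.2) x.2, fun h => ?_, ?_⟩
  · refine (LinearIndependent.pair_iff' hy).mp hxy (-t) (Subtype.ext ?_)
    rw [Submodule.coe_smul, neg_smul, neg_eq_of_add_eq_zero_right h]
  · simp only [IsRoot, eval_add, eval_mul, eval_C, eval_pow, eval_X] at ht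
    simp only [map_add, map_smul, LinearMap.add_apply, LinearMap.smul_apply, smul_eq_mul]
    linear_combination ht

variable {φ : Module.End F V}

lemma isSelfAdjoint_sub_smul_one (hφ : α.IsSelfAdjoint φ) (μ : F) :
    α.IsSelfAdjoint (φ - μ • (1 : Module.End F V)) := fun x y => by simp [hφ x y]

variable [FiniteDimensional F V]

lemma apply_ne_zero_of_isotropic (hα : α.IsSymm) (hnd : α.Nondegenerate)
    (hV : Module.finrank F V < 4) {x y : V} (hxy : LinearIndependent F ![x, y])
    (hx : α x x = 0) (hy : α y y = 0) : α x y ≠ 0 := by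
  intro h
  have hle : Submodule.span F (Set.range ![x, y]) ≤ α.orthogonal (.span F (Set.range ![x, y])) := by
    refine Submodule.span_le.mpr ?_
    rintro _ ⟨i, rfl⟩ z hz
    suffices Submodule.span F (Set.range ![x, y]) ≤ LinearMap.ker (α.flip (![x, y] i)) from this hz
    refine Submodule.span_le.mpr ?_
    rintro _ ⟨j, rfl⟩
    fin_cases i <;> fin_cases j <;> simp [hx, hy, h, hα.eq y x]
  have hrank := Submodule.finrank_mono hle
  rw [LinearMap.BilinForm.finrank_orthogonal hnd, finrank_span_eq_card hxy,
    Fintype.card_fin] at hrank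
  omega

lemma exists_smul_eq_of_isotropic (hα : α.IsSymm) (hnd : α.Nondegenerate)
    (hV : Module.finrank F V < 4) {x y : V} (hx0 : x ≠ 0) (hx : α x x = 0) (hy : α y y = 0)
    (hxy : α x y = 0) : ∃ a : F, a • x = y := by
  by_contra! h
  exact apply_ne_zero_of_isotropic hα hnd hV ((LinearIndependent.pair_iff' hx0).mpr h) hx hy hxy

lemma exists_smul_eq_of_orthogonal (hnd : α.Nondegenerate) (hV : Module.finrank F V = 3)
    {x y r s : V} (hxy : LinearIndependent F ![x, y]) (hr : r ≠ 0) (hxr : α x r = 0)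
    (hyr : α y r = 0) (hxs : α x s = 0) (hys : α y s = 0) : ∃ a : F, a • r = s := by
  set W := α.orthogonal (.span F (Set.range ![x, y])) with hW
  have hmem (t : V) (hx : α x t = 0) (hy : α y t = 0) : t ∈ W := fun u hu => by
    suffices Submodule.span F (Set.range ![x, y]) ≤ LinearMap.ker (α.flip t) from this hu
    refine Submodule.span_le.mpr ?_
    rintro _ ⟨i, rfl⟩
    fin_cases i <;> assumption
  have hrank : Module.finrank F W = 1 := by
    rw [hW, LinearMap.BilinForm.finrank_orthogonal hnd, finrank_span_eq_card hxy, hV,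
      Fintype.card_fin]
  obtain ⟨a, ha⟩ := (finrank_eq_one_iff_of_nonzero' (⟨r, hmem r hxr hyr⟩ : W)
    (by simpa using hr)).mp hrank ⟨s, hmem s hxs hys⟩
  exact ⟨a, congrArg Subtype.val ha⟩

lemma range_eq_orthogonal_ker (hnd : α.Nondegenerate)
    (hφ : α.IsSelfAdjoint φ) : LinearMap.range φ = α.orthogonal (LinearMap.ker φ) := by
  refine Submodule.eq_of_le_of_finrank_eq ?_ ?_
  · rintro _ ⟨w, rfl⟩ x hx
    rw [← hφ, LinearMap.mem_ker.mp hx, map_zero, LinearMap.zero_apply]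
  · rw [LinearMap.BilinForm.finrank_orthogonal hnd, ← φ.finrank_range_add_finrank_ker,
      Nat.add_sub_cancel]

lemma one_lt_rootMultiplicity_of_isotropic (hnd : α.Nondegenerate)
    (hφ : α.IsSelfAdjoint φ) {μ : F} {v : V} (hv : v ≠ 0) (hφv : φ v = μ • v) (hvv : α v v = 0) :
    1 < φ.charpoly.rootMultiplicity μ := by
  by_contra! hle
  rw [← LinearMap.finrank_maxGenEigenspace_eq] at hle
  set N : Module.End F V := φ - μ • (1 : Module.End F V) with hN
  have hNv : N v = 0 := by simp [hN, hφv]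
  have hvE : v ∈ φ.maxGenEigenspace μ := Module.End.mem_maxGenEigenspace .. |>.mpr ⟨1, by simpa⟩
  have hspan : F ∙ v = φ.maxGenEigenspace μ :=
    Submodule.eq_of_le_of_finrank_le ((Submodule.span_singleton_le_iff_mem ..).mpr hvE)
      (by rwa [finrank_span_singleton hv])
  have hker (k : ℕ) (x : V) (hx : (N ^ k) x = 0) : ∃ c : F, c • v = x := by
    rw [← Submodule.mem_span_singleton, hspan]
    exact (Module.End.mem_maxGenEigenspace ..).mpr ⟨k, hx⟩
  have hvN : v ∈ LinearMap.range N := by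
    rw [range_eq_orthogonal_ker hnd (isSelfAdjoint_sub_smul_one hφ μ)]
    intro x hx
    obtain ⟨c, rfl⟩ := hker 1 x (by simpa using hx)
    simp [hvv]
  obtain ⟨w, hw⟩ := hvN
  obtain ⟨c, rfl⟩ := hker 2 w (by rw [pow_two, Module.End.mul_apply, hw, hNv])
  exact hv (by rw [← hw, map_smul, hNv, smul_zero])

lemma exists_isotropic_of_one_lt_rootMultiplicity [IsAlgClosed F]
    (hφ : α.IsSelfAdjoint φ) {μ : F} (hμ : 1 < φ.charpoly.rootMultiplicity μ) :
    ∃ v ≠ 0, φ v = μ • v ∧ α v v = 0 := by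
  rw [← LinearMap.finrank_maxGenEigenspace_eq] at hμ
  by_cases hE : φ.maxGenEigenspace μ ≤ φ.eigenspace μ
  · obtain ⟨v, hv, hv0, hvv⟩ := exists_isotropic_mem α hμ
    exact ⟨v, hv0, Module.End.mem_eigenspace_iff.mp (hE hv), hvv⟩
  · obtain ⟨w, hw, hwN⟩ := SetLike.not_le_iff_exists.mp hE
    set N : Module.End F V := φ - μ • (1 : Module.End F V)
    obtain ⟨k, hk⟩ := (Module.End.mem_maxGenEigenspace ..).mp hw
    obtain ⟨m, hm, hm'⟩ : ∃ m, (N ^ (m + 1)) (N w) = 0 ∧ (N ^ m) (N w) ≠ 0 := by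
      by_contra! h
      have hzero (k : ℕ) : (N ^ k) (N w) = 0 → N w = 0 := k.rec id fun m ih hm => ih (h m hm)
      refine hwN (Module.End.mem_eigenspace_iff.mpr (sub_eq_zero.mp (hzero k ?_)))
      rw [← Module.End.mul_apply, ← pow_succ, pow_succ', Module.End.mul_apply, hk, map_zero]
    have hself : ∀ x y, α (N x) y = α x (N y) := isSelfAdjoint_sub_smul_one hφ μ
    have hcomm : (N ^ m) (N w) = N ((N ^ m) w) := LinearMap.congr_fun (pow_mul_comm' N m) w
    rw [pow_succ', Module.End.mul_apply, hcomm] at hm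
    rw [hcomm] at hm'
    exact ⟨_, hm', sub_eq_zero.mp hm, by rw [hself, hm, map_zero]⟩

open scoped Classical in
lemma squarefree_charpoly_iff [IsAlgClosed F] (hnd : α.Nondegenerate)
    (hφ : α.IsSelfAdjoint φ) :
    Squarefree φ.charpoly ↔ ∀ v ≠ 0, ∀ μ : F, φ v = μ • v → α v v ≠ 0 := by
  rw [← PerfectField.separable_iff_squarefree,
    ← nodup_roots_iff_of_splits φ.charpoly_monic.ne_zero (IsAlgClosed.splits _),
    Multiset.nodup_iff_count_le_one]
  simp only [count_roots]
  constructor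
  · intro h v hv μ hμ hvv
    exact (h μ).not_gt (one_lt_rootMultiplicity_of_isotropic hnd hφ hv hμ hvv)
  · intro h μ
    by_contra! hμ
    obtain ⟨v, hv, hφv, hvv⟩ := exists_isotropic_of_one_lt_rootMultiplicity hφ hμ
    exact h v hv μ hφv hvv

lemma exists_common_isotropic [IsAlgClosed F] (hα : α.IsSymm) (hβ : β.IsSymm)
    (hnd : α.Nondegenerate) (hV : 2 < Module.finrank F V) :
    ∃ v ≠ 0, α v v = 0 ∧ β v v = 0 := by
  have : Nontrivial V := Module.nontrivial_of_finrank_pos (R := F) (by omega)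
  obtain ⟨μ, hμ⟩ := Module.End.exists_eigenvalue (β.symmCompOfNondegenerate α hnd)
  obtain ⟨v, hv⟩ := hμ.exists_hasEigenvector
  have hβv (x : V) : β v x = μ * α v x := by
    rw [← β.symmCompOfNondegenerate_left_apply hnd, hv.apply_eq_smul, map_smul,
      LinearMap.smul_apply, smul_eq_mul]
  obtain ⟨W, hW⟩ := Submodule.exists_isCompl (F ∙ v)
  have hWrank : 1 < Module.finrank F W := by
    have := Submodule.finrank_add_eq_of_isCompl hW
    rw [finrank_span_singleton hv.2] at this
    omega
  obtain ⟨w, hwW, hw, hγw⟩ := exists_isotropic_mem (β - μ • α) hWrank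
  have hvw : LinearIndependent F ![v, w] := by
    refine (LinearIndependent.pair_iff' hv.2).mpr fun c hc => hw ?_
    exact Submodule.disjoint_def.mp hW.disjoint w (Submodule.mem_span_singleton.mpr ⟨c, hc⟩) hwW
  obtain ⟨u, hu, hu0, huu⟩ := exists_isotropic_mem α (W := .span F (Set.range ![v, w])) (by
    rw [finrank_span_eq_card hvw, Fintype.card_fin]
    exact one_lt_two)
  refine ⟨u, hu0, huu, ?_⟩
  rw [Matrix.range_cons, Matrix.range_cons, Matrix.range_empty, Set.union_empty,
    Set.singleton_union] at hu
  obtain ⟨a, b, rfl⟩ := Submodule.mem_span_pair.mp hu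
  simp only [LinearMap.sub_apply, LinearMap.smul_apply, smul_eq_mul, map_add, map_smul,
    LinearMap.add_apply] at hγw huu ⊢
  have hvw : α v w = α w v := hα.eq v w
  have hvw' : β v w = β w v := hβ.eq v w
  rw [← hvw', hβv, hβv]
  linear_combination μ * huu + b ^ 2 * hγw + a * b * μ * hvw

end IsotropicVectors

section Triangles

variable {F V : Type*} [Field F] [AddCommGroup V] [Module F V] {α β : BilinForm F V}

/-- The triangle with vertices `p i` is inscribed in the conic `α = 0` and circumscribed about the
conic `β = 0`: the side opposite to `p i` touches the latter at `r i`. -/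
structure IsPonceletTriangle (α β : BilinForm F V) (p r : Fin 3 → V) : Prop where
  linearIndependent {i j : Fin 3} : i ≠ j → LinearIndependent F ![p i, p j]
  vertex_isotropic (i : Fin 3) : α (p i) (p i) = 0
  contact_ne_zero (i : Fin 3) : r i ≠ 0
  contact_isotropic (i : Fin 3) : β (r i) (r i) = 0
  vertex_contact {i j : Fin 3} : i ≠ j → β (p i) (r j) = 0

/-- At a common point `q` of the conics, the tangent of `β = 0` meets `α = 0` again in `p`, and the
second tangent from `p` to `β = 0` touches at `r`. The Poncelet trajectory through `q` then starts
with `q` and `p`, and it closes up after three steps if `p r` is the tangent of `α = 0` at `p`. -/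
structure IsTangentialPath (α β : BilinForm F V) (p q r : V) : Prop where
  left_pp : α p p = 0
  left_qq : α q q = 0
  left_pq : α p q ≠ 0
  right_qq : β q q = 0
  right_rr : β r r = 0
  right_pq : β p q = 0
  right_pr : β p r = 0
  right_pp : β p p ≠ 0
  right_qr : β q r ≠ 0

/-- A vector version of a point of the incidence curve: `(p, r)` stands for the point `p` of the
conic `α = 0` on the line `β r = 0`, which touches the conic `β = 0` at `r`. -/
structure IsFlag (α β : BilinForm F V) (e : V × V) : Prop where
  point_ne_zero : e.1 ≠ 0
  contact_ne_zero : e.2 ≠ 0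
  point_isotropic : α e.1 e.1 = 0
  contact_isotropic : β e.2 e.2 = 0
  incident : β e.1 e.2 = 0

/-- A vector version of one step of the Poncelet map, starting at the flag `e`. -/
structure IsFlagStep (α β : BilinForm F V) (e e' : V × V) : Prop extends IsFlag α β e where
  incident' : β e'.1 e.2 = 0
  point_eq_iff : (∃ a : F, a • e.1 = e'.1) ↔ ∃ c : F, c • β e.2 = α e.1
  contact_eq_iff : (∃ a : F, a • e.2 = e'.2) ↔ β e'.1 e'.1 = 0

lemma IsTangentialPath.linearIndependent (hβ : β.IsSymm) {p q r : V}
    (h : IsTangentialPath α β p q r) : LinearIndependent F ![p, q, r] := by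
  refine Fintype.linearIndependent_iff.mpr fun c hc => ?_
  simp only [Fin.sum_univ_three, cons_val_zero, cons_val_one, cons_val] at hc
  have hqp : β q p = 0 := (hβ.eq p q).symm.trans h.right_pq
  have h0 : c 0 = 0 := by
    simpa [h.right_pq, h.right_pr, h.right_pp] using congrArg (β p) hc
  have h2 : c 2 = 0 := by
    simpa [h.right_qq, h.right_qr, hqp] using congrArg (β q) hc
  have h1 : c 1 = 0 := by
    simpa [h0, h2, h.left_pq] using congrArg (α p) hc
  intro i
  fin_cases i <;> assumption

lemma IsTangentialPath.isFlagStep (hα : α.IsSymm) (hβ : β.IsSymm)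
    (hV : Module.finrank F V = 3) {p q r : V} (h : IsTangentialPath α β p q r) (hpr : α p r = 0) :
    IsFlagStep α β (q, q) (p, r) ∧ IsFlagStep α β (p, r) (p, q) ∧
      IsFlagStep α β (p, q) (q, q) := by
  have hli := h.linearIndependent hβ
  obtain ⟨hpp, hqq, hpq, hqq', hrr', hpq', hpr', hpp', hqr'⟩ := h
  have hqp : α q p ≠ 0 := (hα.eq p q).symm.trans_ne hpq
  have hqp' : β q p = 0 := (hβ.eq p q).symm.trans hpq'
  have hrp' : β r p = 0 := (hβ.eq p r).symm.trans hpr'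
  have hrq' : β r q ≠ 0 := (hβ.eq q r).symm.trans_ne hqr'
  have htangent : ∃ c : F, c • β r = α p := by
    refine ⟨α p q / β r q, (basisOfLinearIndependentOfCardEqFinrank hli
      (by rw [hV, Fintype.card_fin])).ext fun i => ?_⟩
    fin_cases i <;> simp [hpp, hrp', hpr, hrr', hrq']
  have hp0 : p ≠ 0 := by rintro rfl; simp at hpp'
  have hq0 : q ≠ 0 := by rintro rfl; simp at hpq
  have hr0 : r ≠ 0 := by rintro rfl; simp at hqr'
  refine ⟨⟨⟨hq0, hq0, hqq, hqq', hqq'⟩, hpq', iff_of_false ?_ ?_, iff_of_false ?_ hpp'⟩,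
    ⟨⟨hp0, hr0, hpp, hrr', hpr'⟩, hpr', iff_of_true ⟨1, one_smul F p⟩ htangent,
      iff_of_false ?_ hpp'⟩,
    ⟨⟨hp0, hq0, hpp, hqq', hpq'⟩, hqq', iff_of_false ?_ ?_, iff_of_true ⟨1, one_smul F q⟩ hqq'⟩⟩
  · rintro ⟨a, rfl⟩
    simp [hqq] at hpq
  · rintro ⟨c, hc⟩
    simpa [hqp', hqp.symm] using LinearMap.congr_fun hc p
  · rintro ⟨a, rfl⟩
    simp [hqq'] at hqr'
  · rintro ⟨a, rfl⟩
    simp [hrr'] at hqr'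
  · rintro ⟨a, ha : a • p = q⟩
    exact hpq (by rw [← ha, map_smul, hpp, smul_zero])
  · rintro ⟨c, hc⟩
    simpa [hqq', hpq.symm] using LinearMap.congr_fun hc q

/-- The conics `α = 0` and `β = 0` have distinct tangents at all common points. -/
def IsTransversalPair (α β : BilinForm F V) : Prop :=
  ∀ x ≠ 0, α x x = 0 → β x x = 0 → LinearIndependent F ![α x, β x]

variable [FiniteDimensional F V]

lemma exists_isTangentialPath [IsAlgClosed F] (h2 : (2 : F) ≠ 0) (hα : α.IsSymm) (hβ : β.IsSymm)
    (hα' : α.Nondegenerate) (hβ' : β.Nondegenerate) (hV : Module.finrank F V = 3)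
    (htr : IsTransversalPair α β) : ∃ p q r, IsTangentialPath α β p q r := by
  obtain ⟨q, hq, hqq, hqq'⟩ := exists_common_isotropic hα hβ hα' (by omega)
  obtain ⟨p, hpp, hqp', hpq⟩ := exists_isotropic_of_linearIndependent h2 hα hqq hqq'
    (LinearIndependent.pair_symm_iff.mp (htr q hq hqq hqq'))
  have hpq' : β p q = 0 := (hβ.eq q p).symm.trans hqp'
  have hpp' : β p p ≠ 0 := fun h =>
    apply_ne_zero_of_isotropic hβ hβ' (by omega) (linearIndependent_of_isotropic hpp hpq) h hqq'
      hpq'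
  have hli : LinearIndependent F ![β p, β q] :=
    (linearIndependent_pair_map_iff (LinearMap.ker_eq_bot.mp hβ'.ker_eq_bot)).mpr
      (linearIndependent_of_isotropic hpp hpq)
  obtain ⟨r, hrr', hpr', hrq'⟩ := exists_isotropic_of_linearIndependent h2 hβ hqq' hpq' hli
  exact ⟨p, q, r, hpp, hqq, hpq, hqq', hrr', hpq', hpr', hpp', (hβ.eq r q).symm.trans_ne hrq'⟩

lemma IsFlagStep.not_exists_smul_eq (hα : α.Nondegenerate) (hβ : β.IsSymm)
    (hβ' : β.Nondegenerate) (hV : Module.finrank F V < 4) (htr : IsTransversalPair α β)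
    {e e' : V × V} (h : IsFlagStep α β e e') (he' : IsFlag α β e')
    (htangent : ∃ c : F, c • β e'.2 = α e'.1) : ¬ ∃ a : F, a • e.1 = e'.1 := by
  intro hee'
  obtain ⟨b, hb⟩ := h.point_eq_iff.mp hee'
  obtain ⟨c, hc⟩ := htangent
  obtain ⟨a, ha⟩ := hee'
  have hc0 : c ≠ 0 := by
    rintro rfl
    exact (α.toDual hα).map_ne_zero_iff.mpr he'.point_ne_zero
      (show α e'.1 = 0 by rw [← hc, zero_smul])
  have hcontact : (c⁻¹ * (a * b)) • e.2 = e'.2 := by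
    rw [mul_smul, inv_smul_eq_iff₀ hc0]
    refine (β.toDual hβ').injective ?_
    change β _ = β _
    rw [map_smul, map_smul, hc, ← ha, map_smul, ← hb, mul_smul]
  have hisotropic : β e'.1 e'.1 = 0 := h.contact_eq_iff.mp ⟨_, hcontact⟩
  obtain ⟨d, hd⟩ := exists_smul_eq_of_isotropic hβ hβ' hV he'.contact_ne_zero
    he'.contact_isotropic hisotropic ((hβ.eq e'.1 e'.2).symm.trans he'.incident)
  have hli := htr e'.1 he'.point_ne_zero he'.point_isotropic hisotropic
  refine hc0 (neg_eq_zero.mp (LinearIndependent.pair_iff.mp hli d (-c) ?_).2)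
  nth_rw 2 [← hd]
  rw [← hc, map_smul, smul_comm d c, neg_smul, add_neg_cancel]

lemma exists_isTangentialPath_of_smul_eq (hα : α.IsSymm) (hβ : β.IsSymm)
    (hα' : α.Nondegenerate) (hβ' : β.Nondegenerate) (hV : Module.finrank F V = 3)
    (htr : IsTransversalPair α β) {p₀ p₁ p₂ r₀ r₁ r₂ : V}
    (h₀ : IsFlagStep α β (p₀, r₀) (p₁, r₁)) (h₁ : IsFlagStep α β (p₁, r₁) (p₂, r₂))
    (h₂ : IsFlagStep α β (p₂, r₂) (p₀, r₀)) (h : ∃ a : F, a • p₁ = p₂) :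
    ∃ p q r, IsTangentialPath α β p q r ∧ α p r = 0 := by
  obtain ⟨c, hc⟩ := h₁.point_eq_iff.mp h
  obtain ⟨a, rfl⟩ := h
  simp only at hc
  have ha : a ≠ 0 := (smul_ne_zero_iff.mp h₂.point_ne_zero).1
  have h₀₁ : ¬ ∃ b : F, b • p₀ = p₁ :=
    h₀.not_exists_smul_eq hα' hβ hβ' (by omega) htr h₁.toIsFlag ⟨c, hc⟩
  have hli : LinearIndependent F ![p₀, p₁] :=
    (LinearIndependent.pair_iff' h₀.point_ne_zero).mpr (not_exists.mp h₀₁)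
  have hα₀₁ : α p₀ p₁ ≠ 0 := apply_ne_zero_of_isotropic hα hα' (by omega) hli
    h₀.point_isotropic h₁.point_isotropic
  have hα₁₀ : α p₁ p₀ ≠ 0 := (hα.eq p₀ p₁).symm.trans_ne hα₀₁
  have hr : ∃ b : F, b • r₂ = r₀ := exists_smul_eq_of_orthogonal hβ' hV hli h₂.contact_ne_zero
    h₂.incident' (by simpa [ha] using h₂.incident) h₀.incident h₀.incident'
  have hβ₀ : β p₀ p₀ = 0 := h₂.contact_eq_iff.mp hr
  obtain ⟨d, hd⟩ := exists_smul_eq_of_isotropic hβ hβ' (by omega) h₀.contact_ne_zero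
    h₀.contact_isotropic hβ₀ ((hβ.eq p₀ r₀).symm.trans h₀.incident)
  have hβ₁₀ : β p₁ p₀ = 0 := by rw [← hd, map_smul, h₀.incident', smul_zero]
  refine ⟨p₁, p₀, r₁, ⟨h₁.point_isotropic, h₀.point_isotropic, hα₁₀, hβ₀, h₁.contact_isotropic,
    hβ₁₀, h₁.incident, fun hβ₁ => ?_, fun hβ₀₁ => ?_⟩, ?_⟩
  · exact apply_ne_zero_of_isotropic hβ hβ' (by omega) hli hβ₀ hβ₁ ((hβ.eq p₁ p₀).symm.trans hβ₁₀)
  · have : β r₁ p₀ = 0 := (hβ.eq p₀ r₁).symm.trans hβ₀₁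
    exact hα₁₀ (by rw [← hc, LinearMap.smul_apply, this, smul_zero])
  · rw [← hc, LinearMap.smul_apply, h₁.contact_isotropic, smul_zero]

lemma isPonceletTriangle_or_isTangentialPath (hα : α.IsSymm) (hβ : β.IsSymm)
    (hα' : α.Nondegenerate) (hβ' : β.Nondegenerate) (hV : Module.finrank F V = 3)
    (htr : IsTransversalPair α β) {e₀ e₁ e₂ : V × V} (h₀ : IsFlagStep α β e₀ e₁)
    (h₁ : IsFlagStep α β e₁ e₂) (h₂ : IsFlagStep α β e₂ e₀) :
    (∃ p r, IsPonceletTriangle α β p r) ∨ ∃ p q r, IsTangentialPath α β p q r ∧ α p r = 0 := by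
  by_cases h₀₁ : ∃ a : F, a • e₀.1 = e₁.1
  · exact .inr (exists_isTangentialPath_of_smul_eq hα hβ hα' hβ' hV htr h₂ h₀ h₁ h₀₁)
  by_cases h₁₂ : ∃ a : F, a • e₁.1 = e₂.1
  · exact .inr (exists_isTangentialPath_of_smul_eq hα hβ hα' hβ' hV htr h₀ h₁ h₂ h₁₂)
  by_cases h₂₀ : ∃ a : F, a • e₂.1 = e₀.1
  · exact .inr (exists_isTangentialPath_of_smul_eq hα hβ hα' hβ' hV htr h₁ h₂ h₀ h₂₀)
  have hp₀₁ := (LinearIndependent.pair_iff' h₀.point_ne_zero).mpr (not_exists.mp h₀₁)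
  have hp₁₂ := (LinearIndependent.pair_iff' h₁.point_ne_zero).mpr (not_exists.mp h₁₂)
  have hp₂₀ := (LinearIndependent.pair_iff' h₂.point_ne_zero).mpr (not_exists.mp h₂₀)
  refine .inl ⟨![e₀.1, e₁.1, e₂.1], ![e₁.2, e₂.2, e₀.2], ?_, ?_, ?_, ?_, ?_⟩
  · intro i j hij
    fin_cases i <;> fin_cases j <;>
      first | exact absurd rfl hij | assumption | (rw [LinearIndependent.pair_symm_iff]; assumption)
  · intro i
    fin_cases i
    exacts [h₀.point_isotropic, h₁.point_isotropic, h₂.point_isotropic]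
  · intro i
    fin_cases i
    exacts [h₁.contact_ne_zero, h₂.contact_ne_zero, h₀.contact_ne_zero]
  · intro i
    fin_cases i
    exacts [h₁.contact_isotropic, h₂.contact_isotropic, h₀.contact_isotropic]
  · intro i j hij
    fin_cases i <;> fin_cases j
    exacts [absurd rfl hij, h₂.incident', h₀.incident, h₁.incident, absurd rfl hij, h₀.incident',
      h₁.incident', h₂.incident, absurd rfl hij]

end Triangles

section Gram

variable {F n : Type*} [Field F] [Fintype n]

lemma isSymm_gram (P : Matrix n n F) {A : Matrix n n F} (hA : A.IsSymm) : (P * A * Pᵀ).IsSymm := by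
  rw [IsSymm, transpose_mul, transpose_mul, transpose_transpose, hA.eq, Matrix.mul_assoc]

variable [DecidableEq n]

lemma gram_apply (P A : Matrix n n F) (i j : n) :
    (P * A * Pᵀ) i j = toBilin' A (P i) (P j) := by
  rw [mul_mul_apply, toBilin'_apply', transpose_transpose]

lemma relCharpoly_gram {P A B : Matrix n n F} (hP : P.det ≠ 0) :
    relCharpoly (P * A * Pᵀ) (P * B * Pᵀ) = relCharpoly A B := by
  have hP' : IsUnit P.det := hP.isUnit
  have hPt : IsUnit Pᵀ.det := by rwa [det_transpose]
  simp only [relCharpoly]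
  rw [Matrix.mul_inv_rev, Matrix.mul_inv_rev, ← Matrix.mul_assoc, charpoly_mul_comm]
  simp only [← Matrix.mul_assoc]
  rw [mul_nonsing_inv _ hPt, Matrix.one_mul]
  simp only [Matrix.mul_assoc]
  rw [nonsing_inv_mul_cancel_left _ _ hP']

lemma adjugate_apply_self_eq_zero {A : Matrix n n F} {c : n → F} {k : n} {t : F} (ht : t ≠ 0)
    (hc : A *ᵥ c = Pi.single k t) (h : c ⬝ᵥ A *ᵥ c = 0) : A.adjugate k k = 0 := by
  have hck : c k = 0 := by simpa [hc, ht] using h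
  have := congrFun (congrArg (A.adjugate *ᵥ ·) hc) k
  simpa [mulVec_mulVec, adjugate_mul, smul_mulVec, hck, ht] using this.symm

end Gram

section PencilOfConics

variable {F : Type*} [Field F]

lemma charpoly_fin_three (M : Matrix (Fin 3) (Fin 3) F) :
    M.charpoly = X ^ 3 - C M.trace * X ^ 2 + C M.adjugate.trace * X - C M.det := by
  simp only [charpoly, charmatrix, det_fin_three, adjugate_fin_three, trace_fin_three]
  simp only [scalar_apply, RingHom.mapMatrix_apply, Matrix.sub_apply, diagonal_apply_eq, map_apply,
    ne_eq, Fin.reduceEq, not_false_eq_true, diagonal_apply_ne, zero_sub, mul_neg, neg_mul, neg_neg,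
    zero_ne_one, one_ne_zero, map_add, of_apply, cons_val', cons_val_zero, cons_val_fin_one,
    cons_val_one, cons_val, map_sub, map_mul]
  ring

lemma isCayley_charpoly_iff (M : Matrix (Fin 3) (Fin 3) F) :
    IsCayley M.charpoly ↔ M.adjugate.trace ^ 2 = 4 * M.det * M.trace := by
  rw [IsCayley, charpoly_fin_three]
  simp [coeff_X, coeff_C]

lemma isCayley_relCharpoly_iff {A : Matrix (Fin 3) (Fin 3) F} (B : Matrix (Fin 3) (Fin 3) F)
    (hA : A.det ≠ 0) : IsCayley (relCharpoly A B) ↔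
      (B.adjugate * A).trace ^ 2 = 4 * B.det * (A.adjugate * B).trace := by
  obtain ⟨M, rfl⟩ : ∃ M, B = A * M := ⟨A⁻¹ * B, (mul_nonsing_inv_cancel_left _ _ hA.isUnit).symm⟩
  have htrace : (A.adjugate * (A * M)).trace = A.det * M.trace := by
    rw [← Matrix.mul_assoc, adjugate_mul, smul_mul, Matrix.one_mul, trace_smul, smul_eq_mul]
  have hadj : ((A * M).adjugate * A).trace = A.det * M.adjugate.trace := by
    rw [adjugate_mul_distrib, Matrix.mul_assoc, adjugate_mul, Matrix.mul_smul, Matrix.mul_one,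
      trace_smul, smul_eq_mul]
  rw [relCharpoly, nonsing_inv_mul_cancel_left _ _ hA.isUnit, isCayley_charpoly_iff, htrace, hadj,
    det_mul, ← mul_right_inj' (pow_ne_zero 2 hA)]
  ring_nf

lemma four_mul_trace_adjugate_mul_adjugate {A B : Matrix (Fin 3) (Fin 3) F} (hA : A.IsSymm)
    (hB : B.IsSymm) (hA0 : ∀ i, A i i = 0) (hB0 : ∀ i, B i i = 0) :
    4 * (A.adjugate * B.adjugate).trace = (A * B).trace ^ 2 := by
  simp only [adjugate_fin_three, trace_fin_three, mul_apply, Fin.sum_univ_three, hA0, hB0,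
    hA.apply 0 1, hA.apply 0 2, hA.apply 1 2, hB.apply 0 1, hB.apply 0 2, hB.apply 1 2]
  simp only [mul_zero, zero_sub, neg_zero, zero_add, sub_zero, zero_mul, of_apply, cons_val',
    cons_val_zero, cons_val_fin_one, mul_neg, neg_mul, neg_neg, cons_val_one, cons_val, add_zero]
  ring

lemma det_eq_of_diag_eq_zero {A : Matrix (Fin 3) (Fin 3) F} (hA : A.IsSymm)
    (hA0 : ∀ i, A i i = 0) : A.det = 2 * A 0 1 * A 0 2 * A 1 2 := by
  simp only [det_fin_three, hA0, hA.apply 0 1, hA.apply 0 2, hA.apply 1 2]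
  ring

lemma isCayley_relCharpoly_of_diag_eq_zero {A B : Matrix (Fin 3) (Fin 3) F} (hA : A.IsSymm)
    (hB : B.IsSymm) (hdet : A.det ≠ 0) (hA0 : ∀ i, A i i = 0) (hB0 : ∀ i, B.adjugate i i = 0) :
    IsCayley (relCharpoly A B) := by
  have hBadj : B.adjugate.IsSymm := by rw [IsSymm, adjugate_transpose, hB.eq]
  have := four_mul_trace_adjugate_mul_adjugate hA hBadj hA0 hB0
  rw [adjugate_adjugate _ (by simp)] at this
  rw [isCayley_relCharpoly_iff B hdet, trace_mul_comm, ← this]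
  simp [mul_assoc]

lemma isCayley_relCharpoly_iff_apply_eq_zero (h2 : (2 : F) ≠ 0) {A B : Matrix (Fin 3) (Fin 3) F}
    (hA : A.IsSymm) (hB : B.IsSymm) (hdA : A.det ≠ 0) (hdB : B.det ≠ 0) (hA00 : A 0 0 = 0)
    (hA11 : A 1 1 = 0) (hA01 : A 0 1 ≠ 0) (hB11 : B 1 1 = 0) (hB22 : B 2 2 = 0)
    (hB01 : B 0 1 = 0) (hB02 : B 0 2 = 0) : IsCayley (relCharpoly A B) ↔ A 0 2 = 0 := by
  have hB10 := (hB.apply 0 1).trans hB01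
  have hB20 := (hB.apply 0 2).trans hB02
  have hBdet : B.det = -(B 0 0 * B 1 2 ^ 2) := by
    simp only [det_fin_three, hB11, hB22, hB01, hB02, hB10, hB20, hB.apply 1 2]
    ring
  have hdiff : (B.adjugate * A).trace ^ 2 - 4 * B.det * (A.adjugate * B).trace =
      2 ^ 3 * B 0 0 * B 1 2 ^ 3 * A 0 1 * A 0 2 := by
    simp only [hBdet, adjugate_fin_three, trace_fin_three, mul_apply, Fin.sum_univ_three, hA00,
      hA11, hB11, hB22, hB01, hB02, hB10, hB20, hB.apply 1 2, hA.apply 0 1, hA.apply 0 2,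
      hA.apply 1 2]
    simp only [mul_zero, zero_sub, neg_zero, zero_mul, add_zero, sub_self, of_apply, cons_val',
      cons_val_zero, cons_val_fin_one, cons_val_one, cons_val, neg_mul, zero_add, mul_neg, sub_zero,
      sub_neg_eq_add]
    ring
  have hB0012 : B 0 0 ≠ 0 ∧ B 1 2 ≠ 0 := by simpa [hBdet] using hdB
  rw [isCayley_relCharpoly_iff B hdA, ← sub_eq_zero, hdiff]
  simp [h2, hB0012, hA01]

lemma IsPonceletTriangle.isCayley {A B : Matrix (Fin 3) (Fin 3) F} (h2 : (2 : F) ≠ 0)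
    (hA : A.IsSymm) (hB : B.IsSymm) (hdA : A.det ≠ 0) (hdB : B.det ≠ 0)
    {p r : Fin 3 → Fin 3 → F} (h : IsPonceletTriangle (toBilin' A) (toBilin' B) p r) :
    IsCayley (relCharpoly A B) := by
  have hα : (toBilin' A).IsSymm := isSymm_toBilin'_iff_isSymm.mpr hA
  have hα' := LinearMap.BilinForm.nondegenerate_toBilin'_iff_det_ne_zero.mpr hdA
  set P : Matrix (Fin 3) (Fin 3) F := of p
  have hdiag (i) : (P * A * Pᵀ) i i = 0 := (gram_apply P A i i).trans (h.vertex_isotropic i)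
  have hoff {i j} (hij : i ≠ j) : (P * A * Pᵀ) i j ≠ 0 := by
    rw [gram_apply]
    exact apply_ne_zero_of_isotropic hα hα' (by simp) (h.linearIndependent hij)
      (h.vertex_isotropic i) (h.vertex_isotropic j)
  have hdet : (P * A * Pᵀ).det ≠ 0 := by
    rw [det_eq_of_diag_eq_zero (isSymm_gram P hA) hdiag]
    exact mul_ne_zero (mul_ne_zero (mul_ne_zero h2 (hoff (by simp))) (hoff (by simp)))
      (hoff (by simp))
  have hP : P.det ≠ 0 := fun h0 => hdet (by simp [h0])
  have hPt : IsUnit Pᵀ.det := by rw [det_transpose]; exact hP.isUnit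
  rw [← relCharpoly_gram hP]
  refine isCayley_relCharpoly_of_diag_eq_zero (isSymm_gram _ hA) (isSymm_gram _ hB) hdet hdiag
    fun k => ?_
  have hr : P *ᵥ B *ᵥ r k = Pi.single k (p k ⬝ᵥ B *ᵥ r k) := by
    ext i
    rcases eq_or_ne i k with rfl | hik
    · simp [P, mulVec]
    · rw [Pi.single_eq_of_ne hik]
      exact (toBilin'_apply' B _ _).symm.trans (h.vertex_contact hik)
  have hc : (P * B * Pᵀ) *ᵥ (Pᵀ)⁻¹ *ᵥ r k = Pi.single k (p k ⬝ᵥ B *ᵥ r k) := by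
    rw [mulVec_mulVec, mul_nonsing_inv_cancel_right _ _ hPt, ← mulVec_mulVec, hr]
  refine adjugate_apply_self_eq_zero ?_ hc ?_
  · intro ht
    rw [ht, Pi.single_zero] at hr
    exact h.contact_ne_zero k (eq_zero_of_mulVec_eq_zero hdB (eq_zero_of_mulVec_eq_zero hP hr))
  · rw [hc, ← hr, dotProduct_mulVec, ← mulVec_transpose, mulVec_mulVec, mul_nonsing_inv _ hPt,
      one_mulVec, ← toBilin'_apply']
    exact h.contact_isotropic k

lemma IsTangentialPath.isCayley_iff {A B : Matrix (Fin 3) (Fin 3) F} (h2 : (2 : F) ≠ 0)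
    (hA : A.IsSymm) (hB : B.IsSymm) (hdA : A.det ≠ 0) (hdB : B.det ≠ 0) {p q r : Fin 3 → F}
    (h : IsTangentialPath (toBilin' A) (toBilin' B) p q r) :
    IsCayley (relCharpoly A B) ↔ toBilin' A p r = 0 := by
  have hP : (of ![p, q, r]).det ≠ 0 :=
    ((isUnit_iff_isUnit_det _).mp (linearIndependent_rows_iff_isUnit.mp
      (h.linearIndependent (isSymm_toBilin'_iff_isSymm.mpr hB)))).ne_zero
  have hdet {M : Matrix (Fin 3) (Fin 3) F} (hM : M.det ≠ 0) :
      (of ![p, q, r] * M * (of ![p, q, r])ᵀ).det ≠ 0 := by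
    rw [det_mul, det_mul, det_transpose]
    exact mul_ne_zero (mul_ne_zero hP hM) hP
  rw [← relCharpoly_gram hP, isCayley_relCharpoly_iff_apply_eq_zero h2 (isSymm_gram _ hA)
    (isSymm_gram _ hB) (hdet hdA) (hdet hdB), gram_apply]
  · rfl
  all_goals rw [gram_apply]
  exacts [h.left_pp, h.left_qq, h.left_pq, h.right_qq, h.right_rr, h.right_pq, h.right_pr]

lemma exists_isFlagStep_iff_isCayley [IsAlgClosed F] {A B : Matrix (Fin 3) (Fin 3) F}
    (h2 : (2 : F) ≠ 0) (hA : A.IsSymm) (hB : B.IsSymm) (hdA : A.det ≠ 0) (hdB : B.det ≠ 0)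
    (htr : IsTransversalPair (toBilin' A) (toBilin' B)) :
    (∃ e₀ e₁ e₂, IsFlagStep (toBilin' A) (toBilin' B) e₀ e₁ ∧
      IsFlagStep (toBilin' A) (toBilin' B) e₁ e₂ ∧ IsFlagStep (toBilin' A) (toBilin' B) e₂ e₀) ↔
      IsCayley (relCharpoly A B) := by
  have hα : (toBilin' A).IsSymm := isSymm_toBilin'_iff_isSymm.mpr hA
  have hβ : (toBilin' B).IsSymm := isSymm_toBilin'_iff_isSymm.mpr hB
  have hα' := LinearMap.BilinForm.nondegenerate_toBilin'_iff_det_ne_zero.mpr hdA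
  have hβ' := LinearMap.BilinForm.nondegenerate_toBilin'_iff_det_ne_zero.mpr hdB
  have hV : Module.finrank F (Fin 3 → F) = 3 := Module.finrank_fin_fun F
  constructor
  · rintro ⟨e₀, e₁, e₂, h₀, h₁, h₂⟩
    obtain ⟨p, r, h⟩ | ⟨p, q, r, h, hpr⟩ :=
      isPonceletTriangle_or_isTangentialPath hα hβ hα' hβ' hV htr h₀ h₁ h₂
    · exact h.isCayley h2 hA hB hdA hdB
    · exact (h.isCayley_iff h2 hA hB hdA hdB).mpr hpr
  · intro hcayley
    obtain ⟨p, q, r, h⟩ := exists_isTangentialPath h2 hα hβ hα' hβ' hV htr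
    exact ⟨_, _, _, h.isFlagStep hα hβ hV ((h.isCayley_iff h2 hA hB hdA hdB).mp hcayley)⟩

end PencilOfConics

section Transversality

variable {F n : Type*} [Field F] [Fintype n] [DecidableEq n] {A B : Matrix n n F}

lemma toBilin'_toLin'_inv_mul (hA : A.IsSymm) (hB : B.IsSymm) (hdA : A.det ≠ 0) (v : n → F) :
    toBilin' A (toLin' (A⁻¹ * B) v) = toBilin' B v := by
  refine LinearMap.ext fun w => ?_
  rw [← (isSymm_toBilin'_iff_isSymm.mpr hA).eq, ← (isSymm_toBilin'_iff_isSymm.mpr hB).eq,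
    toBilin'_apply', toBilin'_apply', toLin'_apply, mulVec_mulVec,
    mul_nonsing_inv_cancel_left _ _ hdA.isUnit]

lemma squarefree_relCharpoly_iff [IsAlgClosed F] (hA : A.IsSymm) (hB : B.IsSymm)
    (hdA : A.det ≠ 0) :
    Squarefree (relCharpoly A B) ↔ IsTransversalPair (toBilin' A) (toBilin' B) := by
  have hα : (toBilin' A).IsSymm := isSymm_toBilin'_iff_isSymm.mpr hA
  have hβ : (toBilin' B).IsSymm := isSymm_toBilin'_iff_isSymm.mpr hB
  have hα' := LinearMap.BilinForm.nondegenerate_toBilin'_iff_det_ne_zero.mpr hdA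
  have hφ := toBilin'_toLin'_inv_mul hA hB hdA
  have hinj := LinearMap.ker_eq_bot.mp hα'.ker_eq_bot
  have hadj : (toBilin' A).IsSelfAdjoint (toLin' (A⁻¹ * B)) := fun x y => by
    rw [hφ, ← hα.eq, hφ, hβ.eq]
  have heigen (v : n → F) (μ : F) :
      toLin' (A⁻¹ * B) v = μ • v ↔ toBilin' B v = μ • toBilin' A v := by
    rw [← hφ, ← map_smul, hinj.eq_iff]
  rw [relCharpoly, ← Matrix.charpoly_toLin', squarefree_charpoly_iff hα' hadj]
  constructor
  · intro h x hx hxA _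
    refine (LinearIndependent.pair_iff' ?_).mpr fun μ hμ => h x hx μ ((heigen x μ).mpr hμ.symm) hxA
    exact fun h0 => hx (hinj (h0.trans (map_zero _).symm))
  · intro h v hv μ hμ hvA
    have hB : toBilin' B v = μ • toBilin' A v := (heigen v μ).mp hμ
    have hli := h v hv hvA (by simp [hB, hvA])
    exact (LinearIndependent.pair_iff' (hli.ne_zero 0)).mp hli μ hB.symm

end Transversality

section Hessian

variable {K σ : Type*} [Field K]

/-- The Hessian matrix of a polynomial at the origin. For a quadratic form `f` this is the matrix of
the polar bilinear form of `f`, so that `2 f(x) = xᵀ H x`. -/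
def hessian : MvPolynomial σ K →ₗ[K] Matrix σ σ K where
  toFun f := of fun i j =>
    MvPolynomial.constantCoeff (MvPolynomial.pderiv i (MvPolynomial.pderiv j f))
  map_add' f g := by ext; simp
  map_smul' c f := by ext; simp

lemma two_ne_zero_of_ringHom {R : Type*} [Semiring R] [Nontrivial R] (φ : K →+* R)
    (h2 : (2 : K) ≠ 0) : (2 : R) ≠ 0 := by
  rwa [← map_ofNat φ, _root_.map_ne_zero]

lemma isSymm_hessian (f : MvPolynomial σ K) : (hessian f).IsSymm := by
  classical
  ext i j
  simp [hessian, MvPolynomial.constantCoeff_eq, MvPolynomial.coeff_pderiv, Finsupp.single_apply,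
    add_comm, eq_comm]

lemma exists_hessian_eq [Finite σ] (h2 : (2 : K) ≠ 0) {A : Matrix σ σ K} (hA : A.IsSymm) :
    ∃ f : MvPolynomial σ K, f.IsHomogeneous 2 ∧ hessian f = A := by
  classical
  have := Fintype.ofFinite σ
  refine ⟨∑ i, ∑ j, MvPolynomial.C (A i j / 2) * (MvPolynomial.X i * MvPolynomial.X j), ?_, ?_⟩
  · refine .sum _ _ _ fun i _ => .sum _ _ _ fun j _ => ?_
    exact ((MvPolynomial.isHomogeneous_X K i).mul (MvPolynomial.isHomogeneous_X K j)).C_mul _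
  · have hmonomial (i j : σ) : hessian (MvPolynomial.C (A i j / 2) *
        (MvPolynomial.X i * MvPolynomial.X j)) =
          (2⁻¹ : K) • (single i j (A i j) + (single j i (A j i))) := by
      ext k l
      simp only [hessian, LinearMap.coe_mk, AddHom.coe_mk, Derivation.leibniz, map_add, map_mul,
        MvPolynomial.pderiv_X, Pi.single_apply, smul_eq_mul, mul_ite, mul_one, mul_zero,
        MvPolynomial.derivation_C, add_zero, MvPolynomial.constantCoeff_C, of_apply, hA.apply i j,
        Matrix.smul_apply, Matrix.add_apply, single_apply]
      split_ifs <;> simp_all [div_eq_inv_mul, mul_add]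
    simp only [map_sum, hmonomial, ← Finset.smul_sum, Finset.sum_add_distrib]
    rw [Finset.sum_comm (f := fun i j => single j i (A j i)), ← matrix_eq_sum_single, ← two_smul K,
      inv_smul_smul₀ h2]

variable [Fintype σ]

lemma pderiv_eq_sum_hessian {f : MvPolynomial σ K} (hf : f.IsHomogeneous 2) (j : σ) :
    MvPolynomial.pderiv j f = ∑ i, MvPolynomial.X i * MvPolynomial.C (hessian f i j) := by
  have hlinear : (MvPolynomial.pderiv j f).IsHomogeneous 1 := hf.pderiv
  rw [← one_smul ℕ (MvPolynomial.pderiv j f), ← hlinear.sum_X_mul_pderiv]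
  refine Finset.sum_congr rfl fun i _ => congrArg _ ?_
  have hconstant : (MvPolynomial.pderiv i (MvPolynomial.pderiv j f)).IsHomogeneous 0 :=
    hlinear.pderiv
  exact MvPolynomial.totalDegree_eq_zero_iff_eq_C.mp (Nat.le_zero.mp hconstant.totalDegree_le)

section Evaluation

variable {R : Type*} [CommRing R] [Algebra K R]

lemma aeval_pderiv {f : MvPolynomial σ K} (hf : f.IsHomogeneous 2) (x : σ → R) (i : σ) :
    MvPolynomial.aeval x (MvPolynomial.pderiv i f) = ((hessian f).map (algebraMap K R) *ᵥ x) i := by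
  rw [pderiv_eq_sum_hessian hf]
  simp [mulVec, dotProduct, mul_comm, (isSymm_hessian f).apply i]

lemma two_mul_aeval {f : MvPolynomial σ K} (hf : f.IsHomogeneous 2) (x : σ → R) :
    2 * MvPolynomial.aeval x f = x ⬝ᵥ (hessian f).map (algebraMap K R) *ᵥ x := by
  have heuler := congrArg (MvPolynomial.aeval x) hf.sum_X_mul_pderiv
  simp only [map_sum, map_mul, MvPolynomial.aeval_X, aeval_pderiv hf, map_nsmul] at heuler
  rw [dotProduct, heuler, nsmul_eq_mul, Nat.cast_ofNat]

end Evaluation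

/-- Away from characteristic two, quadratic forms correspond to symmetric matrices. -/
def hessianEquiv (h2 : (2 : K) ≠ 0) :
    MvPolynomial.homogeneousSubmodule σ K 2 ≃ {A : Matrix σ σ K // A.IsSymm} :=
  Equiv.ofBijective (fun f => ⟨hessian f.1, isSymm_hessian f.1⟩) <| by
    constructor
    · intro f g h
      have hfg : hessian f.1 = hessian g.1 := congrArg Subtype.val h
      have hf := two_mul_aeval f.2 (R := MvPolynomial σ K) MvPolynomial.X
      have hg := two_mul_aeval g.2 (R := MvPolynomial σ K) MvPolynomial.X
      rw [hfg, ← hg] at hf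
      simpa using mul_left_cancel₀ (two_ne_zero_of_ringHom MvPolynomial.C h2) hf
    · rintro ⟨A, hA⟩
      obtain ⟨f, hf, hfA⟩ := exists_hessian_eq h2 hA
      exact ⟨⟨f, hf⟩, Subtype.ext hfA⟩

end Hessian

section Dictionary

variable {K : Type*} [Field K]

/-- `M` is the matrix of the polar bilinear form of the conic `C` over the algebraic closure, up to
a nonzero scalar. -/
structure Conic.IsGramMatrix (C : Conic K) (M : Matrix (Fin 3) (Fin 3) (AlgebraicClosure K)) :
    Prop where
  isSymm : M.IsSymm
  onConic_mk_iff {x : Fin 3 → AlgebraicClosure K} (hx : x ≠ 0) :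
    OnConic (.mk _ x hx) C ↔ toBilin' M x x = 0
  exists_gradient_mk_eq {x : Fin 3 → AlgebraicClosure K} (hx : x ≠ 0) :
    ∃ b : AlgebraicClosure K, b ≠ 0 ∧ gradient C (.mk _ x hx) = b • M *ᵥ x

lemma isGramMatrix_mk (h2 : (2 : K) ≠ 0) {f : MvPolynomial.homogeneousSubmodule (Fin 3) K 2}
    (hf : f ≠ 0) : Conic.IsGramMatrix (.mk K f hf)
      ((hessian f.1).map (algebraMap K (AlgebraicClosure K))) := by
  obtain ⟨a, ha⟩ := Projectivization.exists_smul_eq_mk_rep K f hf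
  have hform : Conic.form (.mk K f hf) = a.1 • f.1 := congrArg Subtype.val ha.symm
  have h2' := two_ne_zero_of_ringHom (algebraMap K (AlgebraicClosure K)) h2
  refine ⟨?_, fun {x} hx => ?_, fun {x} hx => ?_⟩
  · rw [IsSymm, ← transpose_map, (isSymm_hessian f.1).eq]
  · obtain ⟨b, hb⟩ := Projectivization.exists_smul_eq_mk_rep (AlgebraicClosure K) x hx
    rw [OnConic, hform, map_smul, smul_eq_zero_iff_right a.ne_zero, ← mul_right_inj' h2', mul_zero,
      two_mul_aeval f.2, ← hb, toBilin'_apply']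
    simp [Units.smul_def, mulVec_smul]
  · obtain ⟨b, hb⟩ := Projectivization.exists_smul_eq_mk_rep (AlgebraicClosure K) x hx
    refine ⟨algebraMap K _ a * b, by simp, ?_⟩
    ext i
    rw [gradient, hform, (MvPolynomial.pderiv i).map_smul, map_smul, aeval_pderiv f.2, ← hb]
    rw [Units.smul_def, mulVec_smul, mul_smul, Pi.smul_apply, Pi.smul_apply, algebraMap_smul]
    rfl

variable {A B : Conic K} {M N : Matrix (Fin 3) (Fin 3) (AlgebraicClosure K)}

lemma toBilin'_eq_dotProductEquiv (hM : M.IsSymm) (x : Fin 3 → AlgebraicClosure K) :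
    toBilin' M x = dotProductEquiv _ _ (M *ᵥ x) := by
  refine LinearMap.ext fun y => ?_
  rw [toBilin'_apply', dotProductEquiv_apply_apply, ← dotProduct_transpose_mulVec, hM.eq,
    dotProduct_comm]

lemma Conic.IsGramMatrix.isSmooth_iff (hA : A.IsGramMatrix M) : IsSmooth A ↔ M.det ≠ 0 := by
  rw [← not_iff_not, not_not, ← exists_mulVec_eq_zero_iff]
  constructor
  · intro h
    simp only [IsSmooth, not_forall, not_not] at h
    obtain ⟨P, -, hP⟩ := h
    induction P using Projectivization.ind with | h x hx =>
    obtain ⟨b, hb, hgrad⟩ := hA.exists_gradient_mk_eq hx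
    exact ⟨x, hx, (smul_eq_zero_iff_right hb).mp (hgrad.symm.trans hP)⟩
  · rintro ⟨x, hx, hMx⟩ hsmooth
    obtain ⟨b, -, hgrad⟩ := hA.exists_gradient_mk_eq hx
    refine hsmooth (.mk _ x hx) ((hA.onConic_mk_iff hx).mpr ?_) ?_
    · rw [toBilin'_apply', hMx, dotProduct_zero]
    · rw [hgrad, hMx, smul_zero]

lemma isTransversal_iff (hA : A.IsGramMatrix M) (hB : B.IsGramMatrix N) :
    IsTransversal A B ↔ IsTransversalPair (toBilin' M) (toBilin' N) := by
  have hli {x : Fin 3 → AlgebraicClosure K} (hx : x ≠ 0) :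
      LinearIndependent (AlgebraicClosure K) ![gradient A (.mk _ x hx), gradient B (.mk _ x hx)] ↔
        LinearIndependent (AlgebraicClosure K) ![toBilin' M x, toBilin' N x] := by
    obtain ⟨a, ha, hgradA⟩ := hA.exists_gradient_mk_eq hx
    obtain ⟨b, hb, hgradB⟩ := hB.exists_gradient_mk_eq hx
    rw [hgradA, hgradB, LinearIndependent.pair_smul_smul_iff ha.isUnit hb.isUnit,
      toBilin'_eq_dotProductEquiv hA.isSymm, toBilin'_eq_dotProductEquiv hB.isSymm]
    exact (linearIndependent_pair_map_iff (dotProductEquiv _ _).injective).symm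
  constructor
  · intro h x hx hxA hxB
    exact (hli hx).mp (h _ ((hA.onConic_mk_iff hx).mpr hxA) ((hB.onConic_mk_iff hx).mpr hxB))
  · intro h P hPA hPB
    induction P using Projectivization.ind with | h x hx =>
    exact (hli hx).mpr (h x hx ((hA.onConic_mk_iff hx).mp hPA) ((hB.onConic_mk_iff hx).mp hPB))

lemma Conic.IsGramMatrix.isTangentAt_mk_iff (hA : A.IsGramMatrix M) (hN : N.IsSymm)
    (hdM : M.det ≠ 0) {p r : Fin 3 → AlgebraicClosure K} (hp : p ≠ 0) (hr : N *ᵥ r ≠ 0) :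
    IsTangentAt A (.mk _ p hp) (.mk _ (N *ᵥ r) hr) ↔
      toBilin' M p p = 0 ∧ ∃ c : AlgebraicClosure K, c • toBilin' N r = toBilin' M p := by
  obtain ⟨a, ha, hgrad⟩ := hA.exists_gradient_mk_eq hp
  obtain ⟨b, hb⟩ := Projectivization.exists_smul_eq_mk_rep (AlgebraicClosure K) (N *ᵥ r) hr
  have hMp : M *ᵥ p ≠ 0 := fun h => hp (eq_zero_of_mulVec_eq_zero hdM h)
  rw [IsTangentAt, hA.onConic_mk_iff, hgrad, ← hb, toBilin'_eq_dotProductEquiv hA.isSymm,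
    toBilin'_eq_dotProductEquiv hN]
  refine and_congr_right fun _ => ?_
  simp only [← map_smul, EmbeddingLike.apply_eq_iff_eq]
  constructor
  · rintro ⟨c, -, hc⟩
    exact ⟨a⁻¹ * (c * b), by rw [mul_smul, mul_smul, inv_smul_eq_iff₀ ha, hc, Units.smul_def]⟩
  · rintro ⟨c, hc⟩
    have hc0 : c ≠ 0 := by
      rintro rfl
      exact hMp (by rw [← hc, zero_smul])
    refine ⟨a * c * b⁻¹, mul_ne_zero (mul_ne_zero ha hc0) b⁻¹.ne_zero, ?_⟩
    rw [← hc, mul_smul, mul_smul, ← Units.smul_def b⁻¹, inv_smul_smul]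

lemma Conic.IsGramMatrix.exists_of_mem_dualConic (hB : B.IsGramMatrix N)
    {ξ : Line K} (hξ : ξ ∈ dualConic B) : ∃ (r : Fin 3 → AlgebraicClosure K) (hNr : N *ᵥ r ≠ 0),
      toBilin' N r r = 0 ∧ .mk _ (N *ᵥ r) hNr = ξ := by
  obtain ⟨Q, hQ, c, hc, hgradQ⟩ := hξ
  induction Q using Projectivization.ind with | h r hr =>
  obtain ⟨b, hb, hgrad⟩ := hB.exists_gradient_mk_eq hr
  have h : (b⁻¹ * c) • ξ.rep = N *ᵥ r := by
    rw [mul_smul, ← hgradQ, hgrad, inv_smul_smul₀ hb]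
  have hNr : N *ᵥ r ≠ 0 := by
    rw [← h]
    exact smul_ne_zero (mul_ne_zero (inv_ne_zero hb) hc) ξ.rep_nonzero
  refine ⟨r, hNr, (hB.onConic_mk_iff hr).mp hQ, ?_⟩
  rw [← ξ.mk_rep, Projectivization.mk_eq_mk_iff']
  exact ⟨_, h⟩

lemma mk_mulVec_eq_mk_mulVec_iff {F n : Type*} [Field F] [Fintype n] [DecidableEq n]
    {N : Matrix n n F} (hdN : N.det ≠ 0) {r r' : n → F} (hr : N *ᵥ r ≠ 0) (hr' : N *ᵥ r' ≠ 0) :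
    Projectivization.mk F (N *ᵥ r') hr' = .mk F (N *ᵥ r) hr ↔ ∃ a : F, a • r = r' := by
  have hinj := mulVec_injective_of_isUnit ((isUnit_iff_isUnit_det N).mpr hdN.isUnit)
  simp only [Projectivization.mk_eq_mk_iff', ← mulVec_smul, hinj.eq_iff]

lemma Conic.IsGramMatrix.mk_mem_dualConic_iff (hB : B.IsGramMatrix N) (hdN : N.det ≠ 0)
    {r : Fin 3 → AlgebraicClosure K} (hNr : N *ᵥ r ≠ 0) :
    .mk _ (N *ᵥ r) hNr ∈ dualConic B ↔ toBilin' N r r = 0 := by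
  constructor
  · intro h
    obtain ⟨s, hNs, hs, heq⟩ := hB.exists_of_mem_dualConic h
    obtain ⟨a, rfl⟩ := (mk_mulVec_eq_mk_mulVec_iff hdN hNs hNr).mp heq.symm
    rw [map_smul, map_smul, LinearMap.smul_apply, hs, smul_zero, smul_zero]
  · intro h
    have hr : r ≠ 0 := by
      rintro rfl
      exact hNr (mulVec_zero N)
    exact ⟨.mk _ r hr, (hB.isTangentAt_mk_iff hB.isSymm hdN hr hNr).mpr ⟨h, 1, one_smul _ _⟩⟩

lemma incident_mk_iff {p r : Fin 3 → AlgebraicClosure K} (hp : p ≠ 0) (hNr : N *ᵥ r ≠ 0) :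
    Incident (.mk _ p hp) (.mk _ (N *ᵥ r) hNr) ↔ toBilin' N p r = 0 := by
  rw [Incident, Projectivization.orthogonal_mk, toBilin'_apply']

lemma mk_mem_incidenceCurve_iff (hA : A.IsGramMatrix M) (hB : B.IsGramMatrix N) (hdN : N.det ≠ 0)
    {p r : Fin 3 → AlgebraicClosure K} (hp : p ≠ 0) (hNr : N *ᵥ r ≠ 0) :
    (.mk _ p hp, .mk _ (N *ᵥ r) hNr) ∈ incidenceCurve A B ↔
      IsFlag (toBilin' M) (toBilin' N) (p, r) := by
  rw [incidenceCurve, Set.mem_ofPred_eq, hA.onConic_mk_iff, hB.mk_mem_dualConic_iff hdN,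
    incident_mk_iff]
  refine ⟨fun ⟨hpp, hrr, hpr⟩ => ⟨hp, fun h => ?_, hpp, hrr, hpr⟩, fun h => ⟨h.3, h.4, h.5⟩⟩
  exact hNr (by rw [show r = 0 from h, mulVec_zero])

lemma Conic.IsGramMatrix.exists_eq_of_mem_incidenceCurve (hB : B.IsGramMatrix N)
    {e : Point K × Line K} (he : e ∈ incidenceCurve A B) :
    ∃ (p r : Fin 3 → AlgebraicClosure K) (hp : p ≠ 0) (hNr : N *ᵥ r ≠ 0),
      e = (.mk _ p hp, .mk _ (N *ᵥ r) hNr) := by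
  obtain ⟨P, ξ⟩ := e
  induction P using Projectivization.ind with | h p hp =>
  obtain ⟨r, hNr, -, rfl⟩ := hB.exists_of_mem_dualConic he.2.1
  exact ⟨p, r, hp, hNr, rfl⟩

lemma ponceletStep_mk_iff (hA : A.IsGramMatrix M) (hB : B.IsGramMatrix N) (hdM : M.det ≠ 0)
    (hdN : N.det ≠ 0) {p r p' r' : Fin 3 → AlgebraicClosure K} (hp : p ≠ 0) (hNr : N *ᵥ r ≠ 0)
    (hp' : p' ≠ 0) (hNr' : N *ᵥ r' ≠ 0) :
    PonceletStep A B (.mk _ p hp, .mk _ (N *ᵥ r) hNr) (.mk _ p' hp', .mk _ (N *ᵥ r') hNr') ↔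
      IsFlagStep (toBilin' M) (toBilin' N) (p, r) (p', r') ∧
        IsFlag (toBilin' M) (toBilin' N) (p', r') := by
  rw [PonceletStep, mk_mem_incidenceCurve_iff hA hB hdN, mk_mem_incidenceCurve_iff hA hB hdN,
    incident_mk_iff, Projectivization.mk_eq_mk_iff', hA.isTangentAt_mk_iff hB.isSymm hdM,
    mk_mulVec_eq_mk_mulVec_iff hdN, hB.onConic_mk_iff]
  constructor
  · rintro ⟨h, h', hinc, hpoint, hcontact⟩
    exact ⟨⟨h, hinc, hpoint.trans (and_iff_right h.point_isotropic), hcontact⟩, h'⟩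
  · rintro ⟨⟨h, hinc, hpoint, hcontact⟩, h'⟩
    exact ⟨h, h', hinc, hpoint.trans (and_iff_right h.point_isotropic).symm, hcontact⟩

lemma ponceletTriangle_iff (hA : A.IsGramMatrix M) (hB : B.IsGramMatrix N) (hdM : M.det ≠ 0)
    (hdN : N.det ≠ 0) : PonceletTriangle A B ↔ ∃ e₀ e₁ e₂,
      IsFlagStep (toBilin' M) (toBilin' N) e₀ e₁ ∧ IsFlagStep (toBilin' M) (toBilin' N) e₁ e₂ ∧
        IsFlagStep (toBilin' M) (toBilin' N) e₂ e₀ := by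
  constructor
  · rintro ⟨_, _, _, h₀, h₁, h₂⟩
    obtain ⟨p₀, r₀, hp₀, hr₀, rfl⟩ := hB.exists_eq_of_mem_incidenceCurve h₀.1
    obtain ⟨p₁, r₁, hp₁, hr₁, rfl⟩ := hB.exists_eq_of_mem_incidenceCurve h₁.1
    obtain ⟨p₂, r₂, hp₂, hr₂, rfl⟩ := hB.exists_eq_of_mem_incidenceCurve h₂.1
    rw [ponceletStep_mk_iff hA hB hdM hdN] at h₀ h₁ h₂
    exact ⟨_, _, _, h₀.1, h₁.1, h₂.1⟩
  · rintro ⟨⟨p₀, r₀⟩, ⟨p₁, r₁⟩, ⟨p₂, r₂⟩, h₀, h₁, h₂⟩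
    have hN {r : Fin 3 → AlgebraicClosure K} (hr : r ≠ 0) : N *ᵥ r ≠ 0 :=
      fun h => hr (eq_zero_of_mulVec_eq_zero hdN h)
    exact ⟨(.mk _ p₀ h₀.1.1, .mk _ (N *ᵥ r₀) (hN h₀.1.2)),
      (.mk _ p₁ h₁.1.1, .mk _ (N *ᵥ r₁) (hN h₁.1.2)),
      (.mk _ p₂ h₂.1.1, .mk _ (N *ᵥ r₂) (hN h₂.1.2)),
      (ponceletStep_mk_iff hA hB hdM hdN ..).mpr ⟨h₀, h₁.1⟩,
      (ponceletStep_mk_iff hA hB hdM hdN ..).mpr ⟨h₁, h₂.1⟩,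
      (ponceletStep_mk_iff hA hB hdM hdN ..).mpr ⟨h₂, h₀.1⟩⟩

end Dictionary

section RelativeCharpoly

variable {K L : Type*} [Field K] [Field L]

lemma relCharpoly_map {n : Type*} [Fintype n] [DecidableEq n] (φ : K →+* L) (A B : Matrix n n K) :
    relCharpoly (A.map φ) (B.map φ) = (relCharpoly A B).map φ := by
  have hinv : (A.map φ)⁻¹ = A⁻¹.map φ := by
    rw [inv_def, inv_def, Ring.inverse_eq_inv', Ring.inverse_eq_inv', ← RingHom.mapMatrix_apply,
      ← RingHom.map_det, ← RingHom.map_adjugate, ← map_inv₀]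
    exact (map_smul' _ _ _ (map_mul φ)).symm
  rw [relCharpoly, hinv, ← Matrix.map_mul, charpoly_map, relCharpoly]

lemma coeff_zero_relCharpoly_eq_zero_iff {n : Type*} [Fintype n] [DecidableEq n]
    {A B : Matrix n n K} (hA : A.det ≠ 0) : (relCharpoly A B).coeff 0 = 0 ↔ B.det = 0 := by
  have hdet : A.det * (A⁻¹ * B).det = B.det := by
    rw [← det_mul, mul_nonsing_inv_cancel_left _ _ hA.isUnit]
  rw [← hdet, mul_eq_zero_iff_left hA, det_eq_sign_charpoly_coeff, mul_eq_zero_iff_left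
    (pow_ne_zero _ (neg_ne_zero.mpr one_ne_zero)), relCharpoly]

lemma isCayley_map_iff (φ : K →+* L) {f : K[X]} : IsCayley (f.map φ) ↔ IsCayley f := by
  simp only [IsCayley, coeff_map]
  rw [← map_ofNat φ, ← map_pow, ← map_mul, ← map_mul, φ.injective.eq_iff]

lemma squarefree_map_iff [PerfectField K] [PerfectField L] (φ : K →+* L) {f : K[X]} :
    Squarefree (f.map φ) ↔ Squarefree f := by
  rw [← PerfectField.separable_iff_squarefree, ← PerfectField.separable_iff_squarefree,
    separable_map]

end RelativeCharpoly

section Counting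

variable {K : Type*} [Field K]

lemma mk_mem_Psi_iff [PerfectField K] (h2 : (2 : K) ≠ 0)
    {f g : MvPolynomial.homogeneousSubmodule (Fin 3) K 2} (hf : f ≠ 0) (hg : g ≠ 0) :
    (.mk K f hf, .mk K g hg) ∈ Psi K ↔ (hessian f.1).det ≠ 0 ∧
      Squarefree (relCharpoly (hessian f.1) (hessian g.1)) ∧
        (relCharpoly (hessian f.1) (hessian g.1)).coeff 0 ≠ 0 := by
  have hA := isGramMatrix_mk h2 hf
  have hB := isGramMatrix_mk h2 hg
  have hdet (f : MvPolynomial (Fin 3) K) :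
      ((hessian f).map (algebraMap K (AlgebraicClosure K))).det ≠ 0 ↔ (hessian f).det ≠ 0 := by
    rw [← RingHom.mapMatrix_apply, ← RingHom.map_det, _root_.map_ne_zero]
  rw [Psi, Set.mem_ofPred_eq, hA.isSmooth_iff, hB.isSmooth_iff, isTransversal_iff hA hB, hdet, hdet]
  refine and_congr_right fun hf' => ?_
  rw [← squarefree_relCharpoly_iff hA.isSymm hB.isSymm ((hdet _).mpr hf'), relCharpoly_map,
    squarefree_map_iff, Ne, Ne, coeff_zero_relCharpoly_eq_zero_iff hf', and_comm]

lemma mk_mem_Gamma3_iff [PerfectField K] (h2 : (2 : K) ≠ 0)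
    {f g : MvPolynomial.homogeneousSubmodule (Fin 3) K 2} (hf : f ≠ 0) (hg : g ≠ 0) :
    (.mk K f hf, .mk K g hg) ∈ Gamma3 K ↔ (hessian f.1).det ≠ 0 ∧
      Squarefree (relCharpoly (hessian f.1) (hessian g.1)) ∧
        (relCharpoly (hessian f.1) (hessian g.1)).coeff 0 ≠ 0 ∧
          IsCayley (relCharpoly (hessian f.1) (hessian g.1)) := by
  have hA := isGramMatrix_mk h2 hf
  have hB := isGramMatrix_mk h2 hg
  have h2' := two_ne_zero_of_ringHom (algebraMap K (AlgebraicClosure K)) h2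
  have hcayley (h : (.mk K f hf, .mk K g hg) ∈ Psi K) :
      PonceletTriangle (.mk K f hf) (.mk K g hg) ↔
        IsCayley (relCharpoly (hessian f.1) (hessian g.1)) := by
    obtain ⟨hsA, hsB, htr⟩ := h
    rw [hA.isSmooth_iff] at hsA
    rw [hB.isSmooth_iff] at hsB
    rw [ponceletTriangle_iff hA hB hsA hsB, exists_isFlagStep_iff_isCayley h2' hA.isSymm hB.isSymm
      hsA hsB ((isTransversal_iff hA hB).mp htr), relCharpoly_map, isCayley_map_iff]
  rw [Gamma3, Set.mem_ofPred_eq, and_congr_right hcayley, mk_mem_Psi_iff h2, and_assoc, and_assoc]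

lemma card_pairs_mk_mem {V : Type*} [AddCommGroup V] [Module K V] (S : Set (ℙ K V × ℙ K V)) :
    Nat.card {p : {v : V // v ≠ 0} × {v : V // v ≠ 0} // (.mk' K p.1, .mk' K p.2) ∈ S} =
      S.ncard * Nat.card Kˣ ^ 2 := by
  let e := Projectivization.nonZeroEquivProjectivizationProdUnits K V
  let E : {p : {v : V // v ≠ 0} × {v : V // v ≠ 0} // (.mk' K p.1, .mk' K p.2) ∈ S} ≃
      S × (Kˣ × Kˣ) :=
    (((e.prodCongr e).trans (Equiv.prodProdProdComm ..)).subtypeEquiv fun _ => .rfl).trans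
      Equiv.prodSubtypeFstEquivSubtypeProd
  rw [Nat.card_congr E, Nat.card_prod, Nat.card_prod, sq, Nat.card_coe_set_eq]

lemma ncard_mul_card_units_sq (h2 : (2 : K) ≠ 0) {S : Set (Conic K × Conic K)} {R : K[X] → Prop}
    (hR : ∀ f, R f → Squarefree f ∧ f.coeff 0 ≠ 0)
    (hS : ∀ (f g : MvPolynomial.homogeneousSubmodule (Fin 3) K 2) (hf : f ≠ 0) (hg : g ≠ 0),
      (.mk K f hf, .mk K g hg) ∈ S ↔
        (hessian f.1).det ≠ 0 ∧ R (relCharpoly (hessian f.1) (hessian g.1))) :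
    S.ncard * Nat.card Kˣ ^ 2 =
      Nat.card {f : K[X] // (f.Monic ∧ f.natDegree = 3) ∧ R f} * Nat.card (GL (Fin 3) K) := by
  have hne {f : MvPolynomial.homogeneousSubmodule (Fin 3) K 2} (hf : (hessian f.1).det ≠ 0) :
      f ≠ 0 := by
    rintro rfl
    exact hf (by rw [ZeroMemClass.coe_zero, map_zero, det_zero])
  have hinj {f g : MvPolynomial.homogeneousSubmodule (Fin 3) K 2} (h : hessian f.1 = hessian g.1) :
      f = g := (hessianEquiv h2).injective (Subtype.ext h)
  have hpairs := card_isSymm_pairs (n := Fin 3) fun f hf => (hR f hf).1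
  rw [Fintype.card_fin] at hpairs
  rw [← card_pairs_mk_mem, ← hpairs]
  refine Nat.card_congr (.ofBijective (fun p => ⟨(hessian p.1.1.1.1, hessian p.1.2.1.1),
    ⟨isSymm_hessian _, isSymm_hessian _, ((hS _ _ p.1.1.2 p.1.2.2).mp p.2).1⟩,
    ((hS _ _ p.1.1.2 p.1.2.2).mp p.2).2⟩) ⟨?_, ?_⟩)
  · rintro ⟨⟨f, g⟩, hfg⟩ ⟨⟨f', g'⟩, hfg'⟩ h
    obtain ⟨hf, hg⟩ := Prod.ext_iff.mp (congrArg Subtype.val h)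
    exact Subtype.ext (Prod.ext (Subtype.ext (hinj hf)) (Subtype.ext (hinj hg)))
  · rintro ⟨⟨A, B⟩, ⟨hA, hB, hdA⟩, h⟩
    obtain ⟨f, hf⟩ := (hessianEquiv h2).surjective ⟨A, hA⟩
    obtain ⟨g, hg⟩ := (hessianEquiv h2).surjective ⟨B, hB⟩
    obtain rfl : hessian f.1 = A := congrArg Subtype.val hf
    obtain rfl : hessian g.1 = B := congrArg Subtype.val hg
    have hdB := mt (coeff_zero_relCharpoly_eq_zero_iff hdA).mpr (hR _ h).2
    exact ⟨⟨(⟨f, hne hdA⟩, ⟨g, hne hdB⟩), (hS ..).mpr ⟨hdA, h⟩⟩, rfl⟩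

variable (K) [Finite K]

lemma ncard_Gamma3 (h2 : (2 : K) ≠ 0) : (Gamma3 K).ncard = Nat.card (GL (Fin 3) K) := by
  have hcount := ncard_mul_card_units_sq h2 (S := Gamma3 K)
    (R := fun f => Squarefree f ∧ f.coeff 0 ≠ 0 ∧ IsCayley f) (fun _ h => ⟨h.1, h.2.1⟩)
    fun _ _ => mk_mem_Gamma3_iff h2
  have hcubics := card_squarefree_isCayley_cubics h2
  rw [Nat.card_eq_card_units_add_one (α := K), Nat.succ_mul, ← sq,
    Nat.add_right_cancel_iff] at hcubics
  rw [hcubics, mul_comm] at hcount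
  exact Nat.eq_of_mul_eq_mul_left (pow_pos Nat.card_pos 2) hcount

lemma ncard_Psi (h2 : (2 : K) ≠ 0) : ((Psi K).ncard : ℚ) * (Nat.card K - 1) =
    ((Nat.card K) ^ 2 - Nat.card K + 1) * Nat.card (GL (Fin 3) K) := by
  have hcount := ncard_mul_card_units_sq h2 (S := Psi K)
    (R := fun f => Squarefree f ∧ f.coeff 0 ≠ 0) (fun _ h => h) fun _ _ => mk_mem_Psi_iff h2
  have hcubics := card_squarefree_cubics (K := K)
  rw [Nat.card_eq_card_units_add_one (α := K)] at hcubics ⊢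
  have hu : (Nat.card Kˣ : ℚ) ≠ 0 := Nat.cast_ne_zero.mpr Nat.card_pos.ne'
  qify at hcount hcubics ⊢
  refine mul_right_cancel₀ hu ?_
  linear_combination hcount + (Nat.card (GL (Fin 3) K) : ℚ) * hcubics

lemma card_GL_fin_three : (Nat.card (GL (Fin 3) K) : ℚ) =
    ((Nat.card K : ℚ) ^ 3 - 1) * ((Nat.card K : ℚ) ^ 3 - Nat.card K) *
      ((Nat.card K : ℚ) ^ 3 - (Nat.card K : ℚ) ^ 2) := by
  have := Fintype.ofFinite K
  have hcast {i : ℕ} (hi : i ≤ 3) : ((Fintype.card K ^ 3 - Fintype.card K ^ i : ℕ) : ℚ) =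
      (Fintype.card K : ℚ) ^ 3 - (Fintype.card K : ℚ) ^ i := by
    rw [Nat.cast_sub (Nat.pow_le_pow_right Fintype.card_pos hi), Nat.cast_pow, Nat.cast_pow]
  rw [Nat.card_eq_fintype_card (α := K), card_GL_field, Fin.prod_univ_three, Nat.cast_mul,
    Nat.cast_mul, hcast (by decide), hcast (by decide), hcast (by decide)]
  norm_num

end Counting

end Poncelet

end

theorem mainTheorem3_general (K : Type*) [Field K] [Finite K] (q : ℕ) (hq : Nat.card K = q)
    (hchar : ringChar K ≠ 2) :
    ((Poncelet.Gamma3 K).ncard : ℚ) =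
        ((q : ℚ) ^ 5 - (q : ℚ) ^ 2) * ((q : ℚ) + 1) * (q : ℚ) * ((q : ℚ) - 1) ^ 2 ∧
      ((Poncelet.Gamma3 K).ncard : ℚ) / ((Poncelet.Psi K).ncard : ℚ) =
        ((q : ℚ) - 1) / ((q : ℚ) ^ 2 - (q : ℚ) + 1) := by
  subst hq
  have h2 : (2 : K) ≠ 0 := Ring.two_ne_zero hchar
  have hPsi := Poncelet.ncard_Psi K h2
  have hcard : (1 : ℚ) < Nat.card K := Nat.one_lt_cast.mpr Finite.one_lt_card
  have hGL : (Nat.card (Matrix.GeneralLinearGroup (Fin 3) K) : ℚ) ≠ 0 :=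
    Nat.cast_ne_zero.mpr Nat.card_pos.ne'
  have hquad : (Nat.card K : ℚ) ^ 2 - Nat.card K + 1 ≠ 0 := by nlinarith
  have hPsi0 : ((Poncelet.Psi K).ncard : ℚ) ≠ 0 :=
    left_ne_zero_of_mul (hPsi.trans_ne (mul_ne_zero hquad hGL))
  rw [Poncelet.ncard_Gamma3 K h2]
  constructor
  · rw [Poncelet.card_GL_fin_three]
    ring
  · rw [div_eq_div_iff hPsi0 hquad]
    linear_combination -hPsi

theorem mainTheorem3 (K : Type*) [Field K] [Finite K] (q : ℕ) (hq : Nat.card K = q)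
    (hchar : 3 < ringChar K) :
    ((Poncelet.Gamma3 K).ncard : ℚ) =
        ((q : ℚ) ^ 5 - (q : ℚ) ^ 2) * ((q : ℚ) + 1) * (q : ℚ) * ((q : ℚ) - 1) ^ 2 ∧
      ((Poncelet.Gamma3 K).ncard : ℚ) / ((Poncelet.Psi K).ncard : ℚ) =
        ((q : ℚ) - 1) / ((q : ℚ) ^ 2 - (q : ℚ) + 1) :=
  mainTheorem3_general K q hq (by omega)
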